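/- Let $m\ge 1$ be an integer, let $u_1,\dots,u_m$ be indeterminates and $\mathbb{K}=\mathbb{C}(u_1,\dots,u_m)$. For $n\ge 1$ let $H_n(\boldsymbol u)$ be the degenerate cyclotomic Hecke algebra of type $G(m,1,n)$ over $\mathbb{K}$, that is, the unital associative $\mathbb{K}$-algebra generated by $t,s_1,\dots,s_{n-1}$ subject to the relations $$(t-u_1)\cdots(t-u_m)=0,\qquad t(s_1ts_1+s_1)=(s_1ts_1+s_1)t,\qquad ts_i=s_it\ (2\le i<n),$$ $$s_i^2=1\ (1\le i<n),\qquad s_is_{i+1}s_i=s_{i+1}s_is_{i+1}\ (1\le i<n-1),\qquad s_is_j=s_js_i\ (|i-j|>1),$$ where the second relation is imposed when $n\ge 2$. Let $H_\infty(\boldsymbol u)=\bigcup_{n\ge1}H_n(\boldsymbol u)$ be the union (direct limit) along the natural maps $H_n(\boldsymbol u)\to H_{n+1}(\boldsymbol u)$, and put $t_1=t$ and $t_{i+1}=s_i\cdots s_1\,t\,s_1\cdots s_i$ for $i\ge 1$. A normalized Markov trace with parameters $z,y_1,\dots,y_{m-1}\in\mathbb{K}$ is a $\mathbb{K}$-linear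 map $\mathrm{tr}:H_\infty(\boldsymbol u)\to\mathbb{K}$ such that 1. $\mathrm{tr}(1)=1$; 2. $\mathrm{tr}(\alpha\beta)=\mathrm{tr}(\beta\alpha)$ for all $\alpha,\beta\in H_\infty(\boldsymbol u)$; 3. $\mathrm{tr}(\alpha s_i)=z\,\mathrm{tr}(\alpha)$ for all $i\ge1$ and $\alpha\in H_i(\boldsymbol u)$; 4. $\mathrm{tr}(\alpha t_{i+1}^k)=y_k\,\mathrm{tr}(\alpha)$ for all $i\ge 1$, $\alpha\in H_i(\boldsymbol u)$ and $1\le k\le m-1$. **Corollary.** There is exactly one normalized Markov trace $\mathrm{tr}_{\boldsymbol 0}$ with parameters $z=y_1=\cdots=y_{m-1}=0$. For every $n\ge 1$ its restriction to $H_n(\boldsymbol u)$ is a canonical trace, that is, a $\mathbb{K}$-linear trace form such that for all $0\le a_1,\dots,a_n\le m-1$ and all $w\in\mathfrak{S}_n$ $$\mathrm{tr}_{\boldsymbol 0}(t_1^{a_1}\cdots t_n^{a_n}w)=\begin{cases}1,&\text{if } a_1=\cdots=a_n=0\text{ and }w=1;\\0,&\text{otherwise.}\end{cases}$$ Here $w=s_{i_1}\cdots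 s_{i_r}\in\mathfrak{S}_n$, with $s_i$ the transposition $(i,i+1)$, is regarded as the element $s_{i_1}\cdots s_{i_r}$ of $H_n(\boldsymbol u)$, for any expression of $w$ as a product of simple transpositions. -/

import Mathlib

noncomputable section

namespace DegHecke

/-- The indices `i` of the simple transpositions `s_i`, `1 ≤ i ≤ n - 1`. -/
abbrev SimpleIdx (n : ℕ) : Type := {i : ℕ // 1 ≤ i ∧ i < n}

/-- The generators `t, s_1, …, s_{n-1}` (for `n ≥ 1`). -/
inductive Gen (n : ℕ) : Type
  | t : Gen n
  | s (i : SimpleIdx n) : Gen n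

section Algebra

variable {R : Type} [CommRing R] {m : ℕ} (u : Fin m → R)

/-- The generator `t` in the free algebra. -/
abbrev freeT (R : Type) [CommRing R] (n : ℕ) : FreeAlgebra R (Gen n) :=
  FreeAlgebra.ι R Gen.t

/-- The generator `s_i` in the free algebra. -/
abbrev freeS (R : Type) [CommRing R] {n : ℕ} (i : SimpleIdx n) : FreeAlgebra R (Gen n) :=
  FreeAlgebra.ι R (Gen.s i)

/-- The defining relations of the degenerate cyclotomic Hecke algebra of type `G(m,1,n)`
with parameters `u_1, …, u_m`. -/
inductive Rel (n : ℕ) : FreeAlgebra R (Gen n) → FreeAlgebra R (Gen n) → Prop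
  /-- `(t - u_1) ⋯ (t - u_m) = 0` -/
  | cyclotomic :
      Rel n (List.ofFn fun j : Fin m => freeT R n - algebraMap R _ (u j)).prod 0
  /-- `t (s_1 t s_1 + s_1) = (s_1 t s_1 + s_1) t` -/
  | t_s_one (i : SimpleIdx n) (hi : i.1 = 1) :
      Rel n (freeT R n * (freeS R i * freeT R n * freeS R i + freeS R i))
        ((freeS R i * freeT R n * freeS R i + freeS R i) * freeT R n)
  /-- `t s_i = s_i t` for `2 ≤ i` -/
  | t_s (i : SimpleIdx n) (hi : 2 ≤ i.1) :
      Rel n (freeT R n * freeS R i) (freeS R i * freeT R n)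
  /-- `s_i ^ 2 = 1` -/
  | s_sq (i : SimpleIdx n) : Rel n (freeS R i * freeS R i) 1
  /-- `s_i s_{i+1} s_i = s_{i+1} s_i s_{i+1}` -/
  | braid (i j : SimpleIdx n) (hij : j.1 = i.1 + 1) :
      Rel n (freeS R i * freeS R j * freeS R i) (freeS R j * freeS R i * freeS R j)
  /-- `s_i s_j = s_j s_i` for `|i - j| > 1` -/
  | s_comm (i j : SimpleIdx n) (hij : i.1 + 1 < j.1 ∨ j.1 + 1 < i.1) :
      Rel n (freeS R i * freeS R j) (freeS R j * freeS R i)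

/-- The degenerate cyclotomic Hecke algebra `H_n(u)` over `R`, for `n ≥ 1`. -/
def Hecke (n : ℕ) : Type := RingQuot (Rel u n)

instance (n : ℕ) : Ring (Hecke u n) := inferInstanceAs (Ring (RingQuot (Rel u n)))

instance (n : ℕ) : Algebra R (Hecke u n) := inferInstanceAs (Algebra R (RingQuot (Rel u n)))

/-- The quotient map from the free algebra. -/
def quot (n : ℕ) : FreeAlgebra R (Gen n) →ₐ[R] Hecke u n := RingQuot.mkAlgHom R (Rel u n)

/-- The generator `t` of `H_n(u)`. -/
def T (n : ℕ) : Hecke u n := quot u n (freeT R n)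

/-- The generator `s_i` of `H_n(u)`, `1 ≤ i < n`. -/
def S {n : ℕ} (i : SimpleIdx n) : Hecke u n := quot u n (freeS R i)

/-- `tElt u n k h` is `t_{k+1} = s_k ⋯ s_1 t s_1 ⋯ s_k` in `H_n(u)`, for `k + 1 ≤ n`. -/
def tElt (n : ℕ) : (k : ℕ) → k < n → Hecke u n
  | 0, _ => T u n
  | k + 1, h =>
      S u ⟨k + 1, Nat.succ_pos k, h⟩ * tElt n k (Nat.lt_of_succ_lt h) *
        S u ⟨k + 1, Nat.succ_pos k, h⟩

/-- A generator of `H_n(u)` regarded as a generator of `H_k(u)`, `n ≤ k`. -/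
def Gen.incl {n k : ℕ} (h : n ≤ k) : Gen n → Gen k
  | .t => .t
  | .s i => .s ⟨i.1, i.2.1, lt_of_lt_of_le i.2.2 h⟩

theorem quot_rel {n : ℕ} {x y : FreeAlgebra R (Gen n)} (h : Rel u n x y) :
    quot u n x = quot u n y := RingQuot.mkAlgHom_rel R h

/-- The canonical homomorphism `H_n(u) → H_k(u)`, `n ≤ k`, with `t ↦ t` and `s_i ↦ s_i`. -/
def incl {n k : ℕ} (h : n ≤ k) : Hecke u n →ₐ[R] Hecke u k :=
  RingQuot.liftAlgHom R
    ⟨FreeAlgebra.lift R fun g => quot u k (FreeAlgebra.ι R (g.incl h)), by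
      intro x y hxy
      cases hxy with
      | cyclotomic =>
        have := quot_rel u (Rel.cyclotomic (u := u) (n := k))
        simp only [map_list_prod, List.map_ofFn, Function.comp_def, map_sub, map_zero,
          AlgHom.commutes] at this
        simpa only [map_list_prod, List.map_ofFn, Function.comp_def, map_sub, map_zero,
          AlgHom.commutes, FreeAlgebra.lift_ι_apply, Gen.incl] using this
      | t_s_one i hi =>
        have := quot_rel u (Rel.t_s_one (u := u) (n := k) ⟨i.1, i.2.1, lt_of_lt_of_le i.2.2 h⟩ hi)
        simpa only [map_mul, map_add, FreeAlgebra.lift_ι_apply, Gen.incl] using this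
      | t_s i hi =>
        have := quot_rel u (Rel.t_s (u := u) (n := k) ⟨i.1, i.2.1, lt_of_lt_of_le i.2.2 h⟩ hi)
        simpa only [map_mul, FreeAlgebra.lift_ι_apply, Gen.incl] using this
      | s_sq i =>
        have := quot_rel u (Rel.s_sq (u := u) (n := k) ⟨i.1, i.2.1, lt_of_lt_of_le i.2.2 h⟩)
        simpa only [map_mul, map_one, FreeAlgebra.lift_ι_apply, Gen.incl] using this
      | braid i j hij =>
        have := quot_rel u (Rel.braid (u := u) (n := k) ⟨i.1, i.2.1, lt_of_lt_of_le i.2.2 h⟩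
          ⟨j.1, j.2.1, lt_of_lt_of_le j.2.2 h⟩ hij)
        simpa only [map_mul, FreeAlgebra.lift_ι_apply, Gen.incl] using this
      | s_comm i j hij =>
        have := quot_rel u (Rel.s_comm (u := u) (n := k) ⟨i.1, i.2.1, lt_of_lt_of_le i.2.2 h⟩
          ⟨j.1, j.2.1, lt_of_lt_of_le j.2.2 h⟩ hij)
        simpa only [map_mul, FreeAlgebra.lift_ι_apply, Gen.incl] using this⟩

theorem incl_quot_ι {n k : ℕ} (h : n ≤ k) (g : Gen n) :
    incl u h (quot u n (FreeAlgebra.ι R g)) = quot u k (FreeAlgebra.ι R (g.incl h)) := by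
  unfold incl quot
  erw [RingQuot.liftAlgHom_mkAlgHom_apply]
  rw [FreeAlgebra.lift_ι_apply]

/-- Two algebra homomorphisms out of `H_n(u)` agree if they agree on the generators. -/
theorem algHom_ext {n : ℕ} {A : Type*} [Semiring A] [Algebra R A] {f g : Hecke u n →ₐ[R] A}
    (h : ∀ x, f (quot u n (FreeAlgebra.ι R x)) = g (quot u n (FreeAlgebra.ι R x))) : f = g := by
  have : f.comp (quot u n) = g.comp (quot u n) := by
    apply FreeAlgebra.hom_ext
    funext x
    exact h x
  exact RingQuot.ringQuot_ext' R f g this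

instance directedSystem :
    DirectedSystem (fun n : ℕ+ => Hecke u n)
      (fun (n k : ℕ+) (h : n ≤ k) => incl u (PNat.coe_le_coe n k |>.mpr h)) where
  map_self n x := by
    have : incl u (le_refl (n : ℕ)) = AlgHom.id R _ := by
      apply algHom_ext
      intro g
      rw [incl_quot_ι]
      cases g <;> rfl
    exact congrArg (fun f => f x) this
  map_map k j i hij hjk x := by
    have : (incl u (PNat.coe_le_coe j k |>.mpr hjk)).comp (incl u (PNat.coe_le_coe i j |>.mpr hij))
        = incl u (PNat.coe_le_coe i k |>.mpr (hij.trans hjk)) := by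
      apply algHom_ext
      intro g
      rw [AlgHom.comp_apply, incl_quot_ι, incl_quot_ι, incl_quot_ι]
      cases g <;> rfl
    exact congrArg (fun f => f x) this

/-- `H_∞(u)`, the union (direct limit) of the `H_n(u)`, `n ≥ 1`. -/
abbrev HeckeInf : Type :=
  DirectLimit (fun n : ℕ+ => Hecke u n)
    (fun (n k : ℕ+) (h : n ≤ k) => incl u (PNat.coe_le_coe n k |>.mpr h))

/-- The canonical map `H_n(u) → H_∞(u)`. -/
def toInf (n : ℕ+) : Hecke u n →ₗ[R] HeckeInf u :=
  DirectLimit.Module.of R ℕ+ (fun n : ℕ+ => Hecke u n)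
    (fun (n k : ℕ+) (h : n ≤ k) => incl u (PNat.coe_le_coe n k |>.mpr h)) n

/-- `s_i ∈ H_∞(u)`, `i ≥ 1`. -/
def sElemInf (i : ℕ+) : HeckeInf u :=
  toInf u (i + 1) (S u ⟨i, i.2, Nat.lt_succ_self _⟩)

/-- `t_{i+1} = s_i ⋯ s_1 t s_1 ⋯ s_i ∈ H_∞(u)`, `i ≥ 1`. -/
def tSuccElemInf (i : ℕ+) : HeckeInf u :=
  toInf u (i + 1) (tElt u (i + 1 : ℕ+) i (Nat.lt_succ_self _))

/-- Normalized Markov traces on `H_∞(u)` with parameters `z, y_1, …, y_{m-1}`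
(the values `y k` for `k = 0` and `k ≥ m` play no role). -/
structure IsNormalizedMarkovTrace (z : R) (y : ℕ → R) (tr : HeckeInf u →ₗ[R] R) : Prop where
  map_one : tr 1 = 1
  map_mul_comm : ∀ a b, tr (a * b) = tr (b * a)
  map_mul_s : ∀ (i : ℕ+) (a : Hecke u i), tr (toInf u i a * sElemInf u i) = z * tr (toInf u i a)
  map_mul_t_pow : ∀ (i : ℕ+) (a : Hecke u i) (k : ℕ), 1 ≤ k → k < m →
    tr (toInf u i a * tSuccElemInf u i ^ k) = y k * tr (toInf u i a)

/-- The simple transposition `s_i = (i, i+1)` of `𝔖_n`, acting on the letters `1, …, n`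
relabelled as `0, …, n - 1`. -/
def adjSwap {n : ℕ} (i : SimpleIdx n) : Equiv.Perm (Fin n) :=
  Equiv.swap ⟨i.1 - 1, lt_of_le_of_lt (Nat.sub_le _ _) i.2.2⟩ ⟨i.1, i.2.2⟩

/-- Every permutation is a product of simple transpositions. -/
theorem exists_word {n : ℕ} (w : Equiv.Perm (Fin n)) :
    ∃ l : List (SimpleIdx n), (l.map adjSwap).prod = w := by
  cases n with
  | zero => exact ⟨[], Subsingleton.elim _ _⟩
  | succ n =>
    have hw : w ∈ Submonoid.closure
        (Set.range fun i : Fin n => Equiv.swap i.castSucc i.succ) := by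
      rw [Equiv.Perm.mclosure_swap_castSucc_succ]; trivial
    induction hw using Submonoid.closure_induction with
    | mem x hx =>
      obtain ⟨i, rfl⟩ := hx
      exact ⟨[⟨i.1 + 1, Nat.succ_pos _, Nat.succ_lt_succ i.2⟩], by simp [adjSwap]; rfl⟩
    | one => exact ⟨[], rfl⟩
    | mul x y _ _ hx hy =>
      obtain ⟨l, rfl⟩ := hx
      obtain ⟨l', rfl⟩ := hy
      exact ⟨l ++ l', by simp⟩

/-- A canonical trace on `H_n(u)`: a linear trace form `τ` which sends
`t_1^{a_1} ⋯ t_n^{a_n} w`, `0 ≤ a_i < m`, `w ∈ 𝔖_n`, to `1` if all `a_i = 0` and `w = 1`, and to `0`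
otherwise. Here `w ∈ 𝔖_n` is regarded as an element of `H_n(u)` through any expression
`w = s_{i_1} ⋯ s_{i_r}` as a product of simple transpositions. -/
structure IsCanonicalTrace (n : ℕ) (τ : Hecke u n →ₗ[R] R) : Prop where
  map_mul_comm : ∀ a b, τ (a * b) = τ (b * a)
  map_word : ∀ (a : Fin n → ℕ), (∀ i, a i < m) → ∀ (w : Equiv.Perm (Fin n))
    (l : List (SimpleIdx n)), (l.map adjSwap).prod = w →
    τ ((List.ofFn fun i : Fin n => tElt u n i.1 i.2 ^ a i).prod * (l.map (S u)).prod) =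
      if (∀ i, a i = 0) ∧ w = 1 then 1 else 0

end Algebra

/-- The field `𝕂 = ℂ(u_1, …, u_m)` of rational functions. -/
abbrev RatField (m : ℕ) : Type := FractionRing (MvPolynomial (Fin m) ℂ)

/-- The indeterminates `u_1, …, u_m` in `𝕂`. -/
def indet (m : ℕ) (j : Fin m) : RatField m :=
  algebraMap (MvPolynomial (Fin m) ℂ) (RatField m) (MvPolynomial.X j)

end DegHecke

end

/-! The parameters force every value of the trace, and an explicit action realises them. Let `p = (X
- u_1) ⋯ (X - u_m)` and let `lam k` be the constant coefficient of the remainder of `X^k` modulo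
`p`. Every `t_{n+1}` is a root of `p`, so a Markov trace with zero parameters satisfies `tr(h
t_{n+1}^k) = lam k * tr h` for `h ∈ H_n` and all `k`, and it vanishes on `H_n s_n H_n`. Forms with
these two properties are called reducing (`IsReducing`).

Uniqueness: `H_{n+1}` is spanned by the `h t_{n+1}^k` and by `H_n s_n H_n` (`mem_te_span`), so a
reducing form is determined by its value at `1`.

Symmetry: every reducing form is a trace (`IsReducing.mul_comm`). By induction on `n` it remains to
move the newest `s` cyclically. On `h s h'` this follows from expanding `h` and `h'` in the spanning
set one level down. For the other spanning elements, powers of `t_{n+1}` are replaced by powers of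
the Jucys-Murphy element, which commutes with `H_n` (`mem_jm_span`, `s_mul_jm_pow`).

Existence: no basis theorem for `H_n` is used. Starting from zero letters, a representation for `n`
letters on an algebra `C` is induced to `n + 1` letters: on the `C`-module of symbols `e k w`,
standing for `t_{n+1}^k w`, right multiplications by permutations and by the `t_i` are written down,
and their relations are checked (`WreathRep.ind`). The matrix coefficient at `e 0 1`, with `e k 1`
counted as `lam k`, commutes with left and right multiplication by `H_n`. Iterating it yields a
reducing form on the direct limit, whose values on the words `t_1^{a_1} ⋯ t_n^{a_n} w` can be read
off (`model_tr_word`). -/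

noncomputable section

namespace DegHecke

/-! ### Commutation relations for the conjugates of `t` and the Jucys-Murphy elements -/

/-- Elements `t, s_0, s_1, …` of a ring satisfying the relations of the degenerate affine
Hecke algebras; `s i` corresponds to the simple transposition `s_{i+1}`. -/
structure AffineGens (E : Type*) [Ring E] where
  t : E
  s : ℕ → E
  s_sq : ∀ i, s i * s i = 1
  braid : ∀ i, s i * s (i + 1) * s i = s (i + 1) * s i * s (i + 1)
  s_comm : ∀ i j, i + 1 < j → Commute (s i) (s j)
  t_s : ∀ i, Commute t (s (i + 1))
  t_s_zero : Commute t (s 0 * t * s 0 + s 0)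

namespace AffineGens

variable {E : Type*} [Ring E] (G : AffineGens E)

/-- The conjugates `t_{k+1} = s_k ⋯ s_1 t s_1 ⋯ s_k`. -/
def te : ℕ → E
  | 0 => G.t
  | k + 1 => G.s k * te k * G.s k

/-- The Jucys-Murphy elements. -/
def jm : ℕ → E
  | 0 => G.t
  | k + 1 => G.s k * jm k * G.s k + G.s k

/-- The transpositions `(1, k + 2)`. -/
def tau : ℕ → E
  | 0 => G.s 0
  | k + 1 => G.s (k + 1) * tau k * G.s (k + 1)

theorem s_sq_mul (i : ℕ) (x : E) : G.s i * (G.s i * x) = x := by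
  rw [← mul_assoc, G.s_sq, one_mul]

theorem conj_mul (i : ℕ) (x y : E) :
    G.s i * (x * y) * G.s i = (G.s i * x * G.s i) * (G.s i * y * G.s i) := by
  simp only [mul_assoc, G.s_sq_mul]

theorem conj_pow (i : ℕ) (x : E) (k : ℕ) :
    G.s i * x ^ k * G.s i = (G.s i * x * G.s i) ^ k := by
  induction k with
  | zero => simp [G.s_sq]
  | succ k ih => rw [pow_succ, conj_mul, ih, pow_succ]

theorem s_mul_te_succ_pow (n k : ℕ) :
    G.s n * G.te (n + 1) ^ k = G.te n ^ k * G.s n := by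
  rw [te, ← conj_pow]
  simp only [mul_assoc, G.s_sq_mul]

theorem te_succ_pow_mul_s (n k : ℕ) :
    G.te (n + 1) ^ k * G.s n = G.s n * G.te n ^ k := by
  rw [te, ← conj_pow]
  simp only [mul_assoc, G.s_sq, mul_one]

theorem s_mul_jm_succ (n : ℕ) : G.s n * G.jm (n + 1) = G.jm n * G.s n + 1 := by
  rw [jm, mul_add, G.s_sq, mul_assoc, G.s_sq_mul]

theorem jm_succ_mul_s (n : ℕ) : G.jm (n + 1) * G.s n = G.s n * G.jm n + 1 := by
  rw [jm, add_mul, G.s_sq, mul_assoc, G.s_sq, mul_one]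

/-- The braid relation turns `s_i` into `s_{i+1}` as it passes `s_{i+1} s_i`; it then passes `x` and
is turned back on the other side. This is the critical case `k = i + 2` for `te k` and `jm k`. -/
theorem commute_s_s_succ (i : ℕ) {x : E} (h : Commute (G.s (i + 1)) x) :
    Commute (G.s i) (G.s (i + 1) * (G.s i * x * G.s i) * G.s (i + 1)) := by
  have b := G.braid i
  have b' : ∀ y, G.s i * (G.s (i + 1) * (G.s i * y)) =
      G.s (i + 1) * (G.s i * (G.s (i + 1) * y)) := fun y => by
    simpa only [mul_assoc] using congrArg (· * y) b
  have h' : ∀ y, G.s (i + 1) * (x * y) = x * (G.s (i + 1) * y) := fun y => by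
    rw [← mul_assoc, h.eq, mul_assoc]
  rw [mul_assoc] at b
  simp only [commute_iff_eq, mul_assoc, b', h', b]

theorem commute_s_conj {i k : ℕ} (hik : i + 1 < k) {x : E} (h : Commute (G.s i) x) :
    Commute (G.s i) (G.s k * x * G.s k) :=
  ((G.s_comm i k hik).mul_right h).mul_right (G.s_comm i k hik)

theorem commute_t_conj {k : ℕ} {x : E} (h : Commute G.t x) :
    Commute G.t (G.s (k + 1) * x * G.s (k + 1)) :=
  ((G.t_s k).mul_right h).mul_right (G.t_s k)

theorem conj_t (k : ℕ) : G.s (k + 1) * G.t * G.s (k + 1) = G.t := by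
  rw [← (G.t_s k).eq, mul_assoc, G.s_sq, mul_one]

theorem t_mul_tau (k : ℕ) : G.t * G.tau k = G.tau k * G.te (k + 1) := by
  induction k with
  | zero => rw [tau, te, te, mul_assoc, G.s_sq_mul]
  | succ k ih => rw [tau, te, ← conj_mul, ← ih, conj_mul, conj_t]

theorem tau_mul_t (k : ℕ) : G.tau k * G.t = G.te (k + 1) * G.tau k := by
  induction k with
  | zero => rw [tau, te, te, mul_assoc, G.s_sq, mul_one]
  | succ k ih => rw [tau, te, ← conj_mul, ← ih, conj_mul, conj_t]

/-- For `k = 0` both products expand, by `s_sq`, to the two sides of `t_s_zero`. Conjugation by the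
next `s`, which fixes `t`, gives the remaining cases. -/
theorem commute_te_add_tau (k : ℕ) : Commute (G.te (k + 1)) (G.t + G.tau k) := by
  induction k with
  | zero =>
    have h := G.t_s_zero.eq
    rw [commute_iff_eq, tau, te, te]
    simp only [mul_add, add_mul, mul_assoc, G.s_sq, G.s_sq_mul, mul_one] at h ⊢
    exact h.symm
  | succ k ih =>
    have : G.t + G.tau (k + 1) = G.s (k + 1) * (G.t + G.tau k) * G.s (k + 1) := by
      rw [mul_add, add_mul, tau, conj_t]
    rw [this, commute_iff_eq, te, ← conj_mul, ← conj_mul, ih.eq]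

theorem tau_mul_t_pow (n k : ℕ) : G.tau n * G.t ^ k = G.te (n + 1) ^ k * G.tau n :=
  ((show SemiconjBy (G.tau n) G.t (G.te (n + 1)) from G.tau_mul_t n).pow_right k).eq

theorem t_pow_mul_tau (n k : ℕ) : G.t ^ k * G.tau n = G.tau n * G.te (n + 1) ^ k :=
  ((show SemiconjBy (G.tau n) (G.te (n + 1)) G.t from (G.t_mul_tau n).symm).pow_right k).eq.symm

/-- Expand the commutation of `te^k` with `t + tau`; since `tau` intertwines `t` and `te`, the
correction can be written with powers of `t` only. In this form it visibly lies in the bimodule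
generated by the newest `s`. -/
theorem te_pow_mul_t (n k : ℕ) :
    G.te (n + 1) ^ k * G.t = G.t * G.te (n + 1) ^ k + (G.t ^ k * G.tau n - G.tau n * G.t ^ k) := by
  have h := ((G.commute_te_add_tau n).pow_left k).eq
  rw [mul_add, add_mul, ← tau_mul_t_pow, ← t_pow_mul_tau] at h
  rw [← add_sub_assoc, ← h, add_sub_cancel_right]

variable (R : Type*) [CommRing R] [Algebra R E]

/-- The subalgebra generated by `t, s_1, …, s_{n-1}`, and the scalars for `n = 0`. -/
def level : ℕ → Subalgebra R E
  | 0 => ⊥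
  | n + 1 => Algebra.adjoin R ({G.t} ∪ G.s '' {i | i < n})

variable {R}

theorem t_mem_level (n : ℕ) : G.t ∈ G.level R (n + 1) :=
  Algebra.subset_adjoin (Or.inl rfl)

theorem s_mem_level {i n : ℕ} (h : i < n) : G.s i ∈ G.level R (n + 1) :=
  Algebra.subset_adjoin (Or.inr ⟨i, h, rfl⟩)

theorem level_le {n : ℕ} {A : Subalgebra R E} (ht : G.t ∈ A) (hs : ∀ i < n, G.s i ∈ A) :
    G.level R (n + 1) ≤ A := by
  refine Algebra.adjoin_le ?_
  rintro x (rfl | ⟨i, hi, rfl⟩)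
  exacts [ht, hs i hi]

theorem level_mono_succ (n : ℕ) : G.level R n ≤ G.level R (n + 1) := by
  cases n with
  | zero => exact bot_le
  | succ n =>
    exact G.level_le (G.t_mem_level _) fun i hi => G.s_mem_level (Nat.lt_succ_of_lt hi)

theorem level_mono : Monotone (G.level R) := monotone_nat_of_le_succ G.level_mono_succ

theorem te_mem_level (n : ℕ) : G.te n ∈ G.level R (n + 1) := by
  induction n with
  | zero => exact G.t_mem_level 0
  | succ n ih =>
    have hs : G.s n ∈ G.level R (n + 2) := G.s_mem_level (Nat.lt_succ_self n)
    exact mul_mem (mul_mem hs (G.level_mono_succ _ ih)) hs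

theorem jm_mem_level (n : ℕ) : G.jm n ∈ G.level R (n + 1) := by
  induction n with
  | zero => exact G.t_mem_level 0
  | succ n ih =>
    have hs : G.s n ∈ G.level R (n + 2) := G.s_mem_level (Nat.lt_succ_self n)
    exact add_mem (mul_mem (mul_mem hs (G.level_mono_succ _ ih)) hs) hs

theorem le_centralizer_of_commute {n : ℕ} {x y : E} (ht : Commute x G.t)
    (hs : ∀ i < n, Commute x (G.s i)) (hy : y ∈ G.level R (n + 1)) : Commute x y := by
  have : G.level R (n + 1) ≤ Subalgebra.centralizer R {x} := by
    refine G.level_le ?_ fun i hi => ?_ <;>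
      simp only [Subalgebra.mem_centralizer_iff, Set.mem_singleton_iff, forall_eq]
    exacts [ht, hs i hi]
  exact (Subalgebra.mem_centralizer_iff R).1 (this hy) x rfl

theorem commute_s_of_mem_level {n i : ℕ} (h : n ≤ i) {x : E} (hx : x ∈ G.level R n) :
    Commute (G.s i) x := by
  cases n with
  | zero =>
    obtain ⟨r, rfl⟩ := Algebra.mem_bot.1 hx
    exact (Algebra.commutes r _).symm
  | succ n =>
    obtain ⟨i, rfl⟩ : ∃ j, i = j + 1 := ⟨i - 1, by omega⟩
    exact G.le_centralizer_of_commute (G.t_s i).symm (fun j hj => (G.s_comm _ _ (by omega)).symm) hx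

theorem commute_te_s {i k : ℕ} (h : i + 1 < k) : Commute (G.s i) (G.te k) := by
  induction k with
  | zero => omega
  | succ k ih =>
    rcases (Nat.lt_succ_iff.1 h).eq_or_lt with rfl | h
    · exact G.commute_s_s_succ i (G.commute_s_of_mem_level (Nat.le_refl _) (G.te_mem_level (R := ℤ) i))
    · exact G.commute_s_conj h (ih h)

theorem commute_jm_s {i k : ℕ} (h : i + 1 < k) : Commute (G.s i) (G.jm k) := by
  induction k with
  | zero => omega
  | succ k ih =>
    rcases (Nat.lt_succ_iff.1 h).eq_or_lt with rfl | h
    · have h1 := G.commute_s_s_succ i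
        (G.commute_s_of_mem_level (Nat.le_refl _) (G.jm_mem_level (R := ℤ) i))
      have h2 : Commute (G.s i) (G.s (i + 1) * G.s i * G.s (i + 1) + G.s (i + 1)) := by
        rw [commute_iff_eq, mul_add, add_mul, ← G.braid, add_comm, mul_assoc (_ * _) (G.s i),
          G.s_sq, ← mul_assoc, ← mul_assoc, G.s_sq]
        simp
      have : G.jm (i + 1 + 1) = G.s (i + 1) * (G.s i * G.jm i * G.s i) * G.s (i + 1) +
          (G.s (i + 1) * G.s i * G.s (i + 1) + G.s (i + 1)) := by
        rw [jm, jm, mul_add, add_mul, add_assoc]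
      rw [this]
      exact h1.add_right h2
    · exact (G.commute_s_conj h (ih h)).add_right (G.s_comm _ _ h)

theorem commute_jm_t (k : ℕ) : Commute G.t (G.jm k) := by
  induction k with
  | zero => exact Commute.refl _
  | succ k ih =>
    cases k with
    | zero => exact G.t_s_zero
    | succ k => exact (G.commute_t_conj ih).add_right (G.t_s k)

/-- This is the advantage of `jm` over `te`: the added term `s k` in its recursion makes the
commutation exact, whereas `te n` commutes with lower elements only modulo a correction. -/
theorem commute_jm_of_mem_level {n : ℕ} {x : E} (hx : x ∈ G.level R n) :
    Commute (G.jm n) x := by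
  cases n with
  | zero =>
    obtain ⟨r, rfl⟩ := Algebra.mem_bot.1 hx
    exact (Algebra.commutes r _).symm
  | succ n =>
    exact G.le_centralizer_of_commute (G.commute_jm_t _).symm
      (fun j hj => (G.commute_jm_s (by omega)).symm) hx

end AffineGens
end DegHecke

/-! ### Spanning sets for the successive levels -/

namespace DegHecke

namespace AffineGens

variable {E : Type*} [Ring E] (G : AffineGens E) {R : Type*} [CommRing R] [Algebra R E]

theorem level_induction {n : ℕ} {p : E → Prop} (hr : ∀ r : R, p (algebraMap R E r))
    (ht : p G.t) (hs : ∀ i < n, p (G.s i)) (hadd : ∀ x y, p x → p y → p (x + y))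
    (hmul : ∀ x ∈ G.level R (n + 1), ∀ y ∈ G.level R (n + 1), p x → p y → p (x * y))
    {x : E} (hx : x ∈ G.level R (n + 1)) : p x := by
  induction hx using Algebra.adjoin_induction with
  | mem x hx =>
    rcases hx with rfl | ⟨i, hi, rfl⟩
    exacts [ht, hs i hi]
  | algebraMap r => exact hr r
  | add x y _ _ hx hy => exact hadd x y hx hy
  | mul x y hx' hy' hx hy => exact hmul x hx' y hy' hx hy

variable (R)

/-- The span of `H_{n+1} s_{n+1} H_{n+1}`. -/
def mid (n : ℕ) : Submodule R E :=
  Submodule.span R {x | ∃ h ∈ G.level R (n + 1), ∃ h' ∈ G.level R (n + 1), x = h * G.s n * h'}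

/-- The span of `H_n s_n H_n`, and `0` for `n = 0`. -/
def prevMid : ℕ → Submodule R E
  | 0 => ⊥
  | n + 1 => G.mid R n

/-- The span of the products of elements of `H_n` with powers of `y`. -/
def powSpan (n : ℕ) (y : E) : Submodule R E :=
  Submodule.span R {x | ∃ h ∈ G.level R n, ∃ k : ℕ, x = h * y ^ k}

variable {R} {G}

theorem mem_mid {n : ℕ} {h h' : E} (hh : h ∈ G.level R (n + 1)) (hh' : h' ∈ G.level R (n + 1)) :
    h * G.s n * h' ∈ G.mid R n :=
  Submodule.subset_span ⟨h, hh, h', hh', rfl⟩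

theorem mem_powSpan {n : ℕ} {h : E} (hh : h ∈ G.level R n) (y : E) (k : ℕ) :
    h * y ^ k ∈ G.powSpan R n y :=
  Submodule.subset_span ⟨h, hh, k, rfl⟩

theorem mid_le {n : ℕ} {M : Submodule R E}
    (H : ∀ h ∈ G.level R (n + 1), ∀ h' ∈ G.level R (n + 1), h * G.s n * h' ∈ M) :
    G.mid R n ≤ M := by
  refine Submodule.span_le.2 ?_
  rintro _ ⟨h, hh, h', hh', rfl⟩
  exact H h hh h' hh'

theorem powSpan_le {n : ℕ} {y : E} {M : Submodule R E}
    (H : ∀ h ∈ G.level R n, ∀ k : ℕ, h * y ^ k ∈ M) : G.powSpan R n y ≤ M := by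
  refine Submodule.span_le.2 ?_
  rintro _ ⟨h, hh, k, rfl⟩
  exact H h hh k

theorem mul_mem_mid {n : ℕ} {a x : E} (ha : a ∈ G.level R (n + 1)) (hx : x ∈ G.mid R n) :
    a * x ∈ G.mid R n := by
  have : G.mid R n ≤ (G.mid R n).comap (LinearMap.mulLeft R a) := mid_le fun h hh h' hh' => by
    simpa [mul_assoc] using mem_mid (mul_mem ha hh) hh'
  exact this hx

theorem mid_mul_mem {n : ℕ} {a x : E} (ha : a ∈ G.level R (n + 1)) (hx : x ∈ G.mid R n) :
    x * a ∈ G.mid R n := by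
  have : G.mid R n ≤ (G.mid R n).comap (LinearMap.mulRight R a) := mid_le fun h hh h' hh' => by
    simpa [mul_assoc] using mem_mid hh (mul_mem hh' ha)
  exact this hx

theorem s_mem_mid (n : ℕ) : G.s n ∈ G.mid R n := by
  simpa using mem_mid (G := G) (n := n) (one_mem (G.level R (n + 1))) (one_mem _)

/-- Conjugation by `s_{n+2}` maps `H_{n+1} s_{n+1} H_{n+1}` into `H_{n+2} s_{n+2} H_{n+2}`. -/
theorem conj_mem_mid {n : ℕ} {x : E} (hx : x ∈ G.mid R n) :
    G.s (n + 1) * x * G.s (n + 1) ∈ G.mid R (n + 1) := by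
  have : G.mid R n ≤ (G.mid R (n + 1)).comap
      (LinearMap.mulLeftRight R (G.s (n + 1), G.s (n + 1))) := mid_le fun h hh h' hh' => by
    have e : G.s (n + 1) * (h * G.s n * h') * G.s (n + 1) =
        (h * G.s n) * G.s (n + 1) * (G.s n * h') := by
      have h1 := (G.commute_s_of_mem_level le_rfl hh).eq
      have h2 := (G.commute_s_of_mem_level le_rfl hh').eq
      have b := G.braid n
      calc _ = (G.s (n + 1) * h) * G.s n * (h' * G.s (n + 1)) := by noncomm_ring
        _ = h * (G.s (n + 1) * G.s n * G.s (n + 1)) * h' := by rw [h1, ← h2]; noncomm_ring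
        _ = _ := by rw [← b]; noncomm_ring
    have hs : G.s n ∈ G.level R (n + 1 + 1) := G.s_mem_level (Nat.lt_succ_self n)
    simp only [Submodule.mem_comap, LinearMap.mulLeftRight_apply, e]
    exact mem_mid (mul_mem (G.level_mono_succ _ hh) hs) (mul_mem hs (G.level_mono_succ _ hh'))
  exact this hx

theorem tau_mem_mid (n : ℕ) : G.tau n ∈ G.mid R n := by
  induction n with
  | zero => exact s_mem_mid 0
  | succ n ih => exact conj_mem_mid ih

/-- The commutator with `te^k` is a derivation and `mid` is a bimodule over the lower level, so only
generators need checking; `t` is the only one with a nonzero commutator. -/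
theorem te_pow_mul_sub_mem_mid (n : ℕ) {b : E} (hb : b ∈ G.level R (n + 1)) (k : ℕ) :
    G.te (n + 1) ^ k * b - b * G.te (n + 1) ^ k ∈ G.mid R n := by
  refine G.level_induction (R := R) (n := n)
    (p := fun b => G.te (n + 1) ^ k * b - b * G.te (n + 1) ^ k ∈ G.mid R n) ?_ ?_ ?_ ?_ ?_ hb
  · intro r
    rw [← Algebra.commutes, sub_self]; exact zero_mem _
  · rw [te_pow_mul_t, add_sub_cancel_left]
    exact sub_mem (mul_mem_mid (pow_mem (G.t_mem_level _) _) (tau_mem_mid n))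
      (mid_mul_mem (pow_mem (G.t_mem_level _) _) (tau_mem_mid n))
  · intro i hi
    rw [((G.commute_te_s (by omega : i + 1 < n + 1)).pow_right k).eq, sub_self]
    exact zero_mem _
  · intro x y hx hy
    convert add_mem hx hy using 1
    noncomm_ring
  · intro x hx' y hy' hx hy
    convert add_mem (mid_mul_mem hy' hx) (mul_mem_mid hx' hy) using 1
    noncomm_ring

/-- `H_{n+1}` is contained in the span of the `H_n t_{n+1}^k` and of `H_n s_n H_n`. -/
theorem mem_te_span {n : ℕ} {x : E} (hx : x ∈ G.level R (n + 1)) :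
    x ∈ G.powSpan R n (G.te n) ⊔ G.prevMid R n := by
  induction n generalizing x with
  | zero =>
    suffices ∀ y ∈ G.powSpan R 0 (G.te 0) ⊔ G.prevMid R 0,
        y * x ∈ G.powSpan R 0 (G.te 0) ⊔ G.prevMid R 0 by
      simpa using this 1 (Submodule.mem_sup_left
        (by simpa using mem_powSpan (one_mem (G.level R 0)) (G.te 0) 0))
    simp only [prevMid, sup_bot_eq]
    refine G.level_induction (R := R) (p := fun x => ∀ y ∈ G.powSpan R 0 (G.te 0),
        y * x ∈ G.powSpan R 0 (G.te 0)) ?_ ?_ ?_ ?_ ?_ hx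
    · intro r y hy
      rw [← Algebra.commutes, ← Algebra.smul_def]; exact Submodule.smul_mem _ _ hy
    · have : G.powSpan R 0 (G.te 0) ≤ (G.powSpan R 0 (G.te 0)).comap (LinearMap.mulRight R G.t) :=
        powSpan_le fun h hh k => by
          simpa [te, mul_assoc, ← pow_succ] using mem_powSpan hh (G.te 0) (k + 1)
      exact fun y hy => this hy
    · simp
    · intro x y hx hy z hz; rw [mul_add]; exact add_mem (hx z hz) (hy z hz)
    · intro x _ y _ hx hy z hz; rw [← mul_assoc]; exact hy _ (hx z hz)
  | succ n ih =>
    -- The sum contains `1`, so stability under right multiplication by the generators suffices. The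
    -- critical generator is `s n`: it sends `h s_n h'` to `h (s_n h' s_n)`, and the inner conjugate
    -- is controlled by applying the induction hypothesis to `h'`.
    have hright : ∀ b ∈ G.level R (n + 1), ∀ y ∈ G.powSpan R (n + 1) (G.te (n + 1)) ⊔ G.mid R n,
        y * b ∈ G.powSpan R (n + 1) (G.te (n + 1)) ⊔ G.mid R n := by
      intro b hb
      have : G.powSpan R (n + 1) (G.te (n + 1)) ⊔ G.mid R n ≤
          (G.powSpan R (n + 1) (G.te (n + 1)) ⊔ G.mid R n).comap (LinearMap.mulRight R b) := by
        refine sup_le (powSpan_le fun h hh k => ?_) fun y hy =>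
          Submodule.mem_sup_right (mid_mul_mem hb hy)
        have e : h * G.te (n + 1) ^ k * b = h * b * G.te (n + 1) ^ k +
            h * (G.te (n + 1) ^ k * b - b * G.te (n + 1) ^ k) := by noncomm_ring
        simp only [Submodule.mem_comap, LinearMap.mulRight_apply, e]
        exact add_mem (Submodule.mem_sup_left (mem_powSpan (mul_mem hh hb) _ _))
          (Submodule.mem_sup_right (mul_mem_mid hh (te_pow_mul_sub_mem_mid n hb k)))
      exact fun y hy => this hy
    have hleft : ∀ b ∈ G.level R (n + 1), ∀ y ∈ G.powSpan R (n + 1) (G.te (n + 1)) ⊔ G.mid R n,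
        b * y ∈ G.powSpan R (n + 1) (G.te (n + 1)) ⊔ G.mid R n := by
      intro b hb
      have : G.powSpan R (n + 1) (G.te (n + 1)) ⊔ G.mid R n ≤
          (G.powSpan R (n + 1) (G.te (n + 1)) ⊔ G.mid R n).comap (LinearMap.mulLeft R b) := by
        refine sup_le (powSpan_le fun h hh k => ?_) fun y hy =>
          Submodule.mem_sup_right (mul_mem_mid hb hy)
        simp only [Submodule.mem_comap, LinearMap.mulLeft_apply, ← mul_assoc]
        exact Submodule.mem_sup_left (mem_powSpan (mul_mem hb hh) _ _)
      exact fun y hy => this hy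
    have hconj : ∀ y ∈ G.level R (n + 1),
        G.s n * y * G.s n ∈ G.powSpan R (n + 1) (G.te (n + 1)) ⊔ G.mid R n := by
      have : G.powSpan R n (G.te n) ⊔ G.prevMid R n ≤
          (G.powSpan R (n + 1) (G.te (n + 1)) ⊔ G.mid R n).comap
            (LinearMap.mulLeftRight R (G.s n, G.s n)) := by
        refine sup_le (powSpan_le fun h hh k => ?_) fun y hy => Submodule.mem_sup_right ?_
        · have e : G.s n * (h * G.te n ^ k) * G.s n = h * G.te (n + 1) ^ k := by
            rw [← mul_assoc, (G.commute_s_of_mem_level le_rfl hh).eq, te, ← conj_pow]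
            noncomm_ring
          simp only [Submodule.mem_comap, LinearMap.mulLeftRight_apply, e]
          exact Submodule.mem_sup_left (mem_powSpan (G.level_mono_succ _ hh) _ _)
        · cases n with
          | zero => simp_all [prevMid]
          | succ n => exact conj_mem_mid hy
      exact fun y hy => this (ih hy)
    have hs : ∀ y ∈ G.powSpan R (n + 1) (G.te (n + 1)) ⊔ G.mid R n,
        y * G.s n ∈ G.powSpan R (n + 1) (G.te (n + 1)) ⊔ G.mid R n := by
      have : G.powSpan R (n + 1) (G.te (n + 1)) ⊔ G.mid R n ≤
          (G.powSpan R (n + 1) (G.te (n + 1)) ⊔ G.mid R n).comap (LinearMap.mulRight R (G.s n)) := by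
        refine sup_le (powSpan_le fun h hh k => ?_) (mid_le fun h hh h' hh' => ?_)
        · simp only [Submodule.mem_comap, LinearMap.mulRight_apply, mul_assoc, te_succ_pow_mul_s]
          rw [← mul_assoc]
          exact Submodule.mem_sup_right (mem_mid hh (pow_mem (G.te_mem_level n) k))
        · simp only [Submodule.mem_comap, LinearMap.mulRight_apply]
          simpa only [mul_assoc] using hleft h hh _ (hconj h' hh')
      exact fun y hy => this hy
    suffices ∀ y ∈ G.powSpan R (n + 1) (G.te (n + 1)) ⊔ G.mid R n,
        y * x ∈ G.powSpan R (n + 1) (G.te (n + 1)) ⊔ G.mid R n by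
      simpa [prevMid] using this 1 (Submodule.mem_sup_left
        (by simpa using mem_powSpan (one_mem (G.level R (n + 1))) (G.te (n + 1)) 0))
    refine G.level_induction (R := R) (p := fun x =>
        ∀ y ∈ G.powSpan R (n + 1) (G.te (n + 1)) ⊔ G.mid R n,
          y * x ∈ G.powSpan R (n + 1) (G.te (n + 1)) ⊔ G.mid R n) ?_ ?_ ?_ ?_ ?_ hx
    · intro r y hy
      rw [← Algebra.commutes, ← Algebra.smul_def]; exact Submodule.smul_mem _ _ hy
    · exact hright _ (G.t_mem_level n)
    · intro i hi
      rcases (Nat.lt_succ_iff.1 hi).eq_or_lt with rfl | hi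
      exacts [hs, hright _ (G.s_mem_level hi)]
    · intro x y hx hy z hz; rw [mul_add]; exact add_mem (hx z hz) (hy z hz)
    · intro x _ y _ hx hy z hz; rw [← mul_assoc]; exact hy _ (hx z hz)

/-- The difference `jm - te` passes to the next level by conjugation and the addition of one new
`s`. Conjugation carries `mid` into the next `mid`, and the new term slides past the power of `te`.
-/
theorem jm_sub_te_mul_te_pow_mem_mid (n k : ℕ) :
    (G.jm (n + 1) - G.te (n + 1)) * G.te (n + 1) ^ k ∈ G.mid R n := by
  induction n with
  | zero =>
    have : G.jm 1 - G.te 1 = G.s 0 := by simp [jm, te]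
    rw [zero_add, this, s_mul_te_succ_pow]
    simpa using mem_mid (pow_mem (G.te_mem_level 0) k) (one_mem (G.level R 1))
  | succ n ih =>
    have e : (G.jm (n + 2) - G.te (n + 2)) * G.te (n + 2) ^ k =
        G.s (n + 1) * ((G.jm (n + 1) - G.te (n + 1)) * G.te (n + 1) ^ k) * G.s (n + 1) +
          G.te (n + 1) ^ k * G.s (n + 1) * 1 := by
      rw [conj_mul, conj_pow, ← s_mul_te_succ_pow, jm, te, mul_one, ← add_mul]
      congr 1
      rw [mul_sub, sub_mul]; abel
    rw [e]
    exact add_mem (conj_mem_mid ih)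
      (mem_mid (pow_mem (G.te_mem_level (n + 1)) k) (one_mem _))

/-- `H_{n+2}` is contained in the span of the products of `H_{n+1}` with powers of the
Jucys-Murphy element, and of `H_{n+1} s_{n+1} H_{n+1}`. -/
theorem mem_jm_span {n : ℕ} {x : E} (hx : x ∈ G.level R (n + 2)) :
    x ∈ G.powSpan R (n + 1) (G.jm (n + 1)) ⊔ G.mid R n := by
  set M := G.powSpan R (n + 1) (G.jm (n + 1)) ⊔ G.mid R n with hM
  have hleft : ∀ b ∈ G.level R (n + 1), ∀ y ∈ M, b * y ∈ M := by
    intro b hb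
    have : M ≤ M.comap (LinearMap.mulLeft R b) := by
      refine sup_le (powSpan_le fun h hh k => ?_) fun y hy =>
        Submodule.mem_sup_right (mul_mem_mid hb hy)
      simp only [Submodule.mem_comap, LinearMap.mulLeft_apply, ← mul_assoc]
      exact Submodule.mem_sup_left (mem_powSpan (mul_mem hb hh) _ _)
    exact fun y hy => this hy
  have hjm : ∀ y ∈ M, G.jm (n + 1) * y ∈ M := by
    have : M ≤ M.comap (LinearMap.mulLeft R (G.jm (n + 1))) := by
      refine sup_le (powSpan_le fun h hh k => ?_) (mid_le fun h hh h' hh' => ?_)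
      · simp only [Submodule.mem_comap, LinearMap.mulLeft_apply, ← mul_assoc,
          (G.commute_jm_of_mem_level hh).eq]
        rw [mul_assoc, ← pow_succ']
        exact Submodule.mem_sup_left (mem_powSpan hh _ _)
      -- `jm (n + 1)` passes `h` freely and crosses `s n` at the cost of `1`, becoming `jm n`, which
      -- belongs to the lower level.
      · have e : G.jm (n + 1) * (h * G.s n * h') = h * G.s n * (G.jm n * h') + h * h' * G.jm (n + 1) ^ 0 := by
          rw [← mul_assoc, ← mul_assoc, (G.commute_jm_of_mem_level hh).eq, mul_assoc h,
            jm_succ_mul_s]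
          noncomm_ring
        simp only [Submodule.mem_comap, LinearMap.mulLeft_apply, e]
        exact add_mem (Submodule.mem_sup_right (mem_mid hh (mul_mem (G.jm_mem_level n) hh')))
          (Submodule.mem_sup_left (mem_powSpan (mul_mem hh hh') _ _))
    exact fun y hy => this hy
  -- One factor `te` at a time is replaced by `jm`; the error lies in `mid`.
  have hte : ∀ k, G.te (n + 1) ^ k ∈ M := by
    intro k
    induction k with
    | zero =>
      exact Submodule.mem_sup_left
        (by simpa using mem_powSpan (one_mem (G.level R (n + 1))) (G.jm (n + 1)) 0)
    | succ k ih =>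
      have e : G.te (n + 1) ^ (k + 1) = G.jm (n + 1) * G.te (n + 1) ^ k -
          (G.jm (n + 1) - G.te (n + 1)) * G.te (n + 1) ^ k := by
        rw [pow_succ']; noncomm_ring
      rw [e]
      exact sub_mem (hjm _ ih) (Submodule.mem_sup_right (jm_sub_te_mul_te_pow_mem_mid n k))
  exact (sup_le (powSpan_le fun h hh k => hleft h hh _ (hte k)) le_sup_right :
    G.powSpan R (n + 1) (G.te (n + 1)) ⊔ G.prevMid R (n + 1) ≤ M) (mem_te_span hx)

end AffineGens
end DegHecke

/-! ### Reducing forms: symmetry and uniqueness -/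

namespace DegHecke

namespace AffineGens

variable {E : Type*} [Ring E] {G : AffineGens E} {R : Type*} [CommRing R] [Algebra R E]

variable (G) in
/-- The linear forms which behave like Markov traces with `z = 0` and which send `h t_{n+1}^k`,
`h ∈ H_n`, to a multiple of the value at `h` depending only on `k`. -/
structure IsReducing (lam : ℕ → R) (tr : E →ₗ[R] R) : Prop where
  te_pow : ∀ n, ∀ h ∈ G.level R n, ∀ k, tr (h * G.te n ^ k) = lam k * tr h
  mid : ∀ n, ∀ x ∈ G.mid R n, tr x = 0

namespace IsReducing

variable {lam : ℕ → R} {tr : E →ₗ[R] R}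

/-- Two linear expressions agree on `H_{n+1}` if they agree on the spanning set. -/
theorem te_span_induction {n : ℕ} {F F' : E →ₗ[R] R}
    (h1 : ∀ h ∈ G.level R n, ∀ k, F (h * G.te n ^ k) = F' (h * G.te n ^ k))
    (h2 : ∀ x ∈ G.prevMid R n, F x = F' x) {x : E} (hx : x ∈ G.level R (n + 1)) :
    F x = F' x :=
  (sup_le (powSpan_le h1) h2 :
    G.powSpan R n (G.te n) ⊔ G.prevMid R n ≤ LinearMap.eqLocus F F') (mem_te_span hx)

theorem prevMid (H : G.IsReducing lam tr) {n : ℕ} {x : E} (hx : x ∈ G.prevMid R n) :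
    tr x = 0 := by
  cases n with
  | zero => rw [(Submodule.mem_bot R).1 hx, map_zero]
  | succ n => exact H.mid n x hx

theorem prevMid_mul_mem {n : ℕ} {a x : E} (ha : a ∈ G.level R n) (hx : x ∈ G.prevMid R n) :
    x * a ∈ G.prevMid R n := by
  cases n with
  | zero => rw [(Submodule.mem_bot R).1 hx, zero_mul]; exact zero_mem _
  | succ n => exact mid_mul_mem ha hx

theorem te_pow_mul (H : G.IsReducing lam tr) {n : ℕ} {h b : E} (hh : h ∈ G.level R (n + 1))
    (hb : b ∈ G.level R (n + 1)) (k : ℕ) :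
    tr (h * G.te (n + 1) ^ k * b) = lam k * tr (h * b) := by
  have e : h * G.te (n + 1) ^ k * b = h * b * G.te (n + 1) ^ k +
      h * (G.te (n + 1) ^ k * b - b * G.te (n + 1) ^ k) := by noncomm_ring
  rw [e, map_add, H.te_pow _ _ (mul_mem hh hb), H.mid n _
    (mul_mem_mid hh (te_pow_mul_sub_mem_mid n hb k)), add_zero]

/-- If the form is symmetric on `H_{n+1}`, elements of `H_{n+1}` may be moved cyclically in
`H_{n+2}`. -/
theorem mul_comm_of_mem (H : G.IsReducing lam tr) {n : ℕ}
    (ih : ∀ a ∈ G.level R (n + 1), ∀ b ∈ G.level R (n + 1), tr (a * b) = tr (b * a))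
    {a b : E} (ha : a ∈ G.level R (n + 2)) (hb : b ∈ G.level R (n + 1)) :
    tr (a * b) = tr (b * a) := by
  refine te_span_induction (F := tr ∘ₗ LinearMap.mulRight R b)
    (F' := tr ∘ₗ LinearMap.mulLeft R b) (fun h hh k => ?_) (fun x hx => ?_) ha
  · simp only [LinearMap.comp_apply, LinearMap.mulRight_apply, LinearMap.mulLeft_apply]
    rw [H.te_pow_mul hh hb, ← mul_assoc, H.te_pow _ _ (mul_mem hb hh), ih h hh b hb]
  · simp only [LinearMap.comp_apply, LinearMap.mulRight_apply, LinearMap.mulLeft_apply]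
    rw [H.mid n _ (mid_mul_mem hb hx), H.mid n _ (mul_mem_mid hb hx)]

/-- `tr (s_n a s_n b)` on the spanning set of `H_n`. -/
theorem conj_te_pow_mul (H : G.IsReducing lam tr) {n : ℕ} {g b : E} (hg : g ∈ G.level R n)
    (hb : b ∈ G.level R (n + 1)) (k : ℕ) :
    tr (G.s n * (g * G.te n ^ k) * G.s n * b) = lam k * tr (g * b) := by
  have e : G.s n * (g * G.te n ^ k) * G.s n = g * G.te (n + 1) ^ k := by
    rw [← mul_assoc, (G.commute_s_of_mem_level le_rfl hg).eq, te, ← conj_pow]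
    noncomm_ring
  rw [e, H.te_pow_mul (G.level_mono_succ _ hg) hb]

theorem mul_conj_te_pow (H : G.IsReducing lam tr) {n : ℕ} {g b : E} (hg : g ∈ G.level R n)
    (hb : b ∈ G.level R (n + 1)) (k : ℕ) :
    tr (b * (G.s n * (g * G.te n ^ k) * G.s n)) = lam k * tr (b * g) := by
  have e : G.s n * (g * G.te n ^ k) * G.s n = g * G.te (n + 1) ^ k := by
    rw [← mul_assoc, (G.commute_s_of_mem_level le_rfl hg).eq, te, ← conj_pow]
    noncomm_ring
  rw [e, ← mul_assoc, H.te_pow _ _ (mul_mem hb (G.level_mono_succ _ hg))]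

theorem conj_prevMid_mem {n : ℕ} {x : E} (hx : x ∈ G.prevMid R n) :
    G.s n * x * G.s n ∈ G.mid R n := by
  cases n with
  | zero => rw [(Submodule.mem_bot R).1 hx]; simp
  | succ n => exact conj_mem_mid hx

theorem mem_level_of_mem_prevMid {n : ℕ} {x : E} (hx : x ∈ G.prevMid R n) :
    x ∈ G.level R (n + 1) := by
  cases n with
  | zero => rw [(Submodule.mem_bot R).1 hx]; exact zero_mem _
  | succ n =>
    exact (mid_le fun a ha b hb => Subalgebra.mul_mem _
      (Subalgebra.mul_mem _ (G.level_mono_succ _ ha) (G.s_mem_level (Nat.lt_succ_self n)))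
      (G.level_mono_succ _ hb) : G.mid R n ≤ Subalgebra.toSubmodule (G.level R (n + 2))) hx

/-- Expand `h` and `h'` in the spanning set of their level. For `g te^k` and `g' te^k'` both sides
are `lam k * lam k' * tr (g g')`, by symmetry one level down. If either lies in `prevMid`, both
sides vanish. -/
theorem s_mul_mid (H : G.IsReducing lam tr) {n : ℕ}
    (ih : ∀ a ∈ G.level R (n + 1), ∀ b ∈ G.level R (n + 1), tr (a * b) = tr (b * a))
    {h h' : E} (hh : h ∈ G.level R (n + 1)) (hh' : h' ∈ G.level R (n + 1)) :
    tr (G.s n * h * G.s n * h') = tr (h * (G.s n * h' * G.s n)) := by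
  refine te_span_induction (F := tr ∘ₗ LinearMap.mulRight R h' ∘ₗ
    LinearMap.mulLeftRight R (G.s n, G.s n)) (F' := tr ∘ₗ LinearMap.mulRight R
    (G.s n * h' * G.s n)) (fun g hg k => ?_) (fun x hx => ?_) hh
  · have hgk : g * G.te n ^ k ∈ G.level R (n + 1) :=
      mul_mem (G.level_mono_succ _ hg) (pow_mem (G.te_mem_level n) k)
    refine te_span_induction (F := tr ∘ₗ LinearMap.mulLeft R
      (G.s n * (g * G.te n ^ k) * G.s n)) (F' := tr ∘ₗ LinearMap.mulLeft R (g * G.te n ^ k) ∘ₗ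
      LinearMap.mulLeftRight R (G.s n, G.s n)) (fun g' hg' k' => ?_) (fun x hx => ?_) hh'
    · have hg'k : g' * G.te n ^ k' ∈ G.level R (n + 1) :=
        mul_mem (G.level_mono_succ _ hg') (pow_mem (G.te_mem_level n) k')
      simp only [LinearMap.comp_apply, LinearMap.mulLeft_apply, LinearMap.mulLeftRight_apply]
      rw [H.conj_te_pow_mul hg hg'k, H.mul_conj_te_pow hg' hgk, ← mul_assoc g g',
        H.te_pow _ _ (mul_mem hg hg'), ih _ hgk _ (G.level_mono_succ _ hg'), ← mul_assoc g' g,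
        H.te_pow _ _ (mul_mem hg' hg), ih _ (G.level_mono_succ _ hg) _ (G.level_mono_succ _ hg')]
      ring
    · have hx' := mem_level_of_mem_prevMid hx
      simp only [LinearMap.comp_apply, LinearMap.mulLeft_apply, LinearMap.mulLeftRight_apply]
      rw [H.conj_te_pow_mul hg hx', H.mid n _ (mul_mem_mid hgk (conj_prevMid_mem hx)),
        ih _ (G.level_mono_succ _ hg) _ hx', H.prevMid (prevMid_mul_mem hg hx), mul_zero]
  · have hx' := mem_level_of_mem_prevMid hx
    simp only [LinearMap.comp_apply, LinearMap.mulRight_apply, LinearMap.mulLeftRight_apply]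
    rw [H.mid n _ (mid_mul_mem hh' (conj_prevMid_mem hx))]
    refine te_span_induction (F := 0) (F' := tr ∘ₗ LinearMap.mulLeft R x ∘ₗ
      LinearMap.mulLeftRight R (G.s n, G.s n)) (fun g hg k => ?_) (fun y hy => ?_) hh'
    · simp only [LinearMap.comp_apply, LinearMap.mulLeft_apply, LinearMap.mulLeftRight_apply,
        LinearMap.zero_apply]
      rw [H.mul_conj_te_pow hg hx', H.prevMid (prevMid_mul_mem hg hx), mul_zero]
    · simp only [LinearMap.comp_apply, LinearMap.mulLeft_apply, LinearMap.mulLeftRight_apply,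
        LinearMap.zero_apply]
      rw [H.mid n _ (mul_mem_mid hx' (conj_prevMid_mem hy))]

/-- Write `J = jm n`, `J' = jm (n + 1)`. From `s J' = J s + 1` and `J' s = s J + 1`, removing one
`J'` creates a `J` on different sides of `h`. The second assertion says that this side is
irrelevant, so the two are proved by a joint induction on `k`. -/
theorem s_mul_jm_pow (H : G.IsReducing lam tr) {n : ℕ}
    (ih : ∀ a ∈ G.level R (n + 1), ∀ b ∈ G.level R (n + 1), tr (a * b) = tr (b * a)) (k : ℕ) :
    (∀ h ∈ G.level R (n + 1), tr (G.s n * (h * G.jm (n + 1) ^ k)) =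
        tr (h * G.jm (n + 1) ^ k * G.s n)) ∧
      ∀ h ∈ G.level R (n + 1), tr (G.s n * (h * G.jm n * G.jm (n + 1) ^ k)) =
        tr (G.s n * (G.jm n * h * G.jm (n + 1) ^ k)) := by
  have hJ : G.jm n ∈ G.level R (n + 1) := G.jm_mem_level n
  have hs : G.s n ∈ G.level R (n + 2) := G.s_mem_level (Nat.lt_succ_self n)
  have hJ' : ∀ k, G.jm (n + 1) ^ k ∈ G.level R (n + 2) := fun k => pow_mem (G.jm_mem_level _) k
  have up : ∀ {x}, x ∈ G.level R (n + 1) → x ∈ G.level R (n + 2) := fun h => G.level_mono_succ _ h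
  have cyc := fun {a b : E} (ha : a ∈ G.level R (n + 2)) (hb : b ∈ G.level R (n + 1)) =>
    H.mul_comm_of_mem ih ha hb
  have hcomm : ∀ h ∈ G.level R (n + 1), ∀ k, G.jm (n + 1) ^ k * h = h * G.jm (n + 1) ^ k :=
    fun h hh k => ((G.commute_jm_of_mem_level hh).pow_left k).eq
  induction k with
  | zero =>
    have z1 : ∀ h ∈ G.level R (n + 1), tr (G.s n * h) = 0 := fun h hh =>
      H.mid n _ (mid_mul_mem hh (s_mem_mid n))
    have z2 : ∀ h ∈ G.level R (n + 1), tr (h * G.s n) = 0 := fun h hh =>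
      H.mid n _ (mul_mem_mid hh (s_mem_mid n))
    refine ⟨fun h hh => ?_, fun h hh => ?_⟩
    · rw [pow_zero, mul_one, z1 h hh, z2 h hh]
    · rw [pow_zero, mul_one, mul_one, z1 _ (mul_mem hh hJ), z1 _ (mul_mem hJ hh)]
  | succ k ihk =>
    have step : ∀ h ∈ G.level R (n + 1), tr (G.s n * (h * G.jm (n + 1) ^ (k + 1))) =
        tr (G.s n * (h * G.jm n * G.jm (n + 1) ^ k)) + tr (h * G.jm (n + 1) ^ k) := by
      intro h hh
      have e : G.s n * (h * G.jm (n + 1) ^ (k + 1)) =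
          G.jm n * (G.s n * (h * G.jm (n + 1) ^ k)) + h * G.jm (n + 1) ^ k := by
        calc _ = G.s n * (G.jm (n + 1) ^ 1 * h) * G.jm (n + 1) ^ k := by
              rw [hcomm h hh, pow_succ']; noncomm_ring
          _ = (G.s n * G.jm (n + 1)) * (h * G.jm (n + 1) ^ k) := by noncomm_ring
          _ = _ := by rw [s_mul_jm_succ]; noncomm_ring
      -- The leading `J` lies in the lower level, so it can be moved cyclically to the end and then
      -- past the power of `J'`.
      rw [e, map_add, ← cyc (mul_mem hs (mul_mem (up hh) (hJ' k))) hJ, mul_assoc, mul_assoc h,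
        hcomm _ hJ, ← mul_assoc h]
    have step' : ∀ h ∈ G.level R (n + 1), tr (h * G.jm (n + 1) ^ (k + 1) * G.s n) =
        tr (G.jm n * h * G.jm (n + 1) ^ k * G.s n) + tr (h * G.jm (n + 1) ^ k) := by
      intro h hh
      have e : h * G.jm (n + 1) ^ (k + 1) * G.s n =
          h * G.jm (n + 1) ^ k * G.s n * G.jm n + h * G.jm (n + 1) ^ k := by
        calc _ = h * G.jm (n + 1) ^ k * (G.jm (n + 1) * G.s n) := by rw [pow_succ]; noncomm_ring
          _ = _ := by rw [jm_succ_mul_s]; noncomm_ring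
      rw [e, map_add, cyc (mul_mem (mul_mem (up hh) (hJ' k)) hs) hJ]
      simp only [mul_assoc]
    refine ⟨fun h hh => ?_, fun h hh => ?_⟩
    · rw [step h hh, step' h hh, ihk.2 h hh, ihk.1 _ (mul_mem hJ hh)]
    · rw [step _ (mul_mem hh hJ), step _ (mul_mem hJ hh), ihk.2 _ (mul_mem hh hJ),
        ← mul_assoc (G.jm n), mul_assoc h (G.jm n) (_ ^ k), ← hcomm _ hJ, ← mul_assoc h,
        cyc (mul_mem (up hh) (hJ' k)) hJ, ← mul_assoc (G.jm n)]

theorem mul_comm (H : G.IsReducing lam tr) {n : ℕ} {a b : E} (ha : a ∈ G.level R n)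
    (hb : b ∈ G.level R n) : tr (a * b) = tr (b * a) := by
  have h1 : ∀ n, ∀ a ∈ G.level R (n + 1), ∀ b ∈ G.level R (n + 1), tr (a * b) = tr (b * a) := by
    intro n
    induction n with
    | zero =>
      intro a ha b hb
      -- The first level is generated by `t` alone, hence commutative.
      refine congrArg tr (Commute.eq ?_)
      exact G.le_centralizer_of_commute
        (G.le_centralizer_of_commute (Commute.refl G.t) (by simp) ha).symm (by simp) hb
    | succ n ih =>
      intro a ha b hb
      -- The elements `b` that can be moved cyclically past every `a` are closed under sums and
      -- products, so generators suffice.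
      refine G.level_induction (R := R) (p := fun b => ∀ a ∈ G.level R (n + 2),
        tr (a * b) = tr (b * a)) ?_ ?_ ?_ ?_ ?_ hb a ha
      · intro r a _; rw [Algebra.commutes]
      · exact fun a ha => H.mul_comm_of_mem ih ha (G.t_mem_level n)
      · intro i hi a ha
        rcases (Nat.lt_succ_iff.1 hi).eq_or_lt with rfl | hi
        · refine (sup_le (powSpan_le fun h hh k => ?_) (mid_le fun h hh h' hh' => ?_) :
            G.powSpan R (i + 1) (G.jm (i + 1)) ⊔ G.mid R i ≤ LinearMap.eqLocus
              (tr ∘ₗ LinearMap.mulRight R (G.s i)) (tr ∘ₗ LinearMap.mulLeft R (G.s i)))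
            (mem_jm_span ha)
          · exact ((H.s_mul_jm_pow ih k).1 h hh).symm
          · have := H.s_mul_mid ih hh hh'
            simp only [LinearMap.mem_eqLocus, LinearMap.comp_apply, LinearMap.mulRight_apply,
              LinearMap.mulLeft_apply, ← mul_assoc] at this ⊢
            exact this.symm
        · exact H.mul_comm_of_mem ih ha (G.s_mem_level hi)
      · intro x y hx hy a ha
        rw [mul_add, add_mul, map_add, map_add, hx a ha, hy a ha]
      · intro x hx' y hy' hx hy a ha
        rw [← mul_assoc, hy _ (mul_mem ha hx'), ← mul_assoc, hx _ (mul_mem hy' ha), mul_assoc]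
  exact h1 n a (G.level_mono_succ _ ha) b (G.level_mono_succ _ hb)

theorem eq_of_map_one {tr' : E →ₗ[R] R} (H : G.IsReducing lam tr) (H' : G.IsReducing lam tr')
    (h1 : tr 1 = tr' 1) {n : ℕ} {x : E} (hx : x ∈ G.level R n) : tr x = tr' x := by
  induction n generalizing x with
  | zero =>
    obtain ⟨r, rfl⟩ := Algebra.mem_bot.1 hx
    rw [Algebra.algebraMap_eq_smul_one, map_smul, map_smul, h1]
  | succ n ih =>
    refine te_span_induction (fun h hh k => ?_) (fun x hx => ?_) hx
    · rw [H.te_pow n h hh, H'.te_pow n h hh, ih hh]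
    · rw [H.prevMid hx, H'.prevMid hx]

end IsReducing

end AffineGens
end DegHecke

/-! ### The induced module and right multiplication on it -/

namespace DegHecke

open Polynomial Equiv

/-- With `x = t_{n+1}`, `y = t_a` and `s` the transposition of `a` and `n + 1`, this is the rule
that dictates `tAct`. -/
theorem pow_mul_of_comm {A : Type*} [Ring A] {x y s : A} (h : x * y = y * x + (y - x) * s)
    (hx : s * x = y * s) (k : ℕ) : x ^ k * y = y * x ^ k + (y ^ k - x ^ k) * s := by
  induction k with
  | zero => simp
  | succ k ih =>
    calc x ^ (k + 1) * y = x ^ k * (x * y) := by rw [pow_succ, mul_assoc]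
      _ = (x ^ k * y) * x + x ^ k * (y - x) * s := by rw [h]; noncomm_ring
      _ = y * x ^ (k + 1) + (y ^ k - x ^ k) * (s * x) + x ^ k * (y - x) * s := by
        rw [ih, pow_succ]; noncomm_ring
      _ = _ := by rw [hx, pow_succ, pow_succ]; noncomm_ring

theorem aeval_mul_of_comm {R A : Type*} [CommRing R] [Ring A] [Algebra R A] {x y s : A}
    (h : x * y = y * x + (y - x) * s) (hx : s * x = y * s) (q : R[X]) :
    aeval x q * y = y * aeval x q + (aeval y q - aeval x q) * s := by
  induction q using Polynomial.induction_on' with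
  | add q r hq hr => simp only [map_add, add_mul, hq, hr]; noncomm_ring
  | monomial k a =>
    simp only [aeval_monomial, mul_assoc, pow_mul_of_comm h hx, ← mul_sub]
    rw [mul_add, ← mul_assoc, ← mul_assoc, ← mul_assoc y, Algebra.commutes a y, mul_assoc y]

/-- The embedding of the permutations of `n` letters into those of `n + 1` letters. -/
def extendPerm (n : ℕ) : Perm (Fin n) →* Perm (Fin (n + 1)) where
  toFun g := finSuccEquivLast.trans (g.optionCongr.trans finSuccEquivLast.symm)
  map_one' := by ext x; simp [Perm.one_def]
  map_mul' g h := by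
    ext x
    refine Fin.lastCases ?_ (fun i => ?_) x <;> simp [Perm.mul_apply]

@[simp] theorem extendPerm_last {n : ℕ} (g : Perm (Fin n)) :
    extendPerm n g (Fin.last n) = Fin.last n := by simp [extendPerm]

@[simp] theorem extendPerm_castSucc {n : ℕ} (g : Perm (Fin n)) (i : Fin n) :
    extendPerm n g i.castSucc = (g i).castSucc := by simp [extendPerm]

theorem extendPerm_injective (n : ℕ) : Function.Injective (extendPerm n) := by
  intro g h e
  ext i
  have := congrArg (fun w : Perm (Fin (n + 1)) => w i.castSucc) e
  simpa [Fin.ext_iff] using this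

theorem extendPerm_swap {n : ℕ} (a b : Fin n) :
    extendPerm n (swap a b) = swap a.castSucc b.castSucc := by
  ext x
  refine Fin.lastCases ?_ (fun i => ?_) x
  · simp [swap_apply_of_ne_of_ne, (Fin.castSucc_lt_last _).ne']
  · rw [extendPerm_castSucc, (Fin.castSucc_injective n).swap_apply]

variable {R : Type} [CommRing R]

/-- Elements of an algebra satisfying the relations between the permutations of `n` letters and
the conjugates `t_1, …, t_n` of `t`, for a cyclotomic polynomial `p`. -/
structure WreathRep (p : R[X]) (n : ℕ) (C : Type) [Ring C] [Algebra R C] where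
  σ : Perm (Fin n) →* C
  t : Fin n → C
  conj : ∀ w i, σ w * t i = t (w i) * σ w
  comm : ∀ i j, i ≠ j → t i * t j = t j * t i + (t j - t i) * σ (swap i j)
  aeval_t : ∀ i, aeval (t i) p = 0

namespace WreathRep

variable {p : R[X]} {n : ℕ} {C : Type} [Ring C] [Algebra R C] (D : WreathRep p n C)

theorem sum_t (i : Fin n) : (p.sum fun l a => algebraMap R C a * D.t i ^ l) = 0 := by
  rw [← D.aeval_t i, aeval_def, eval₂_eq_sum]

/-- The relations of the induced module. -/
def relSet : Set ((ℕ × Perm (Fin (n + 1))) →₀ C) :=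
  {x | ∃ k g w, x = D.σ g • Finsupp.single (k, w) 1 - Finsupp.single (k, extendPerm n g * w) 1} ∪
    {x | ∃ k w, x = p.sum fun l a => algebraMap R C a • Finsupp.single (k + l, w) 1}

/-- The left `C`-module induced from `n` to `n + 1` letters: it is spanned by the symbols
`e k w`, which stand for `t_{n+1}^k w`. -/
abbrev Ind : Type := ((ℕ × Perm (Fin (n + 1))) →₀ C) ⧸ Submodule.span C D.relSet

/-- The class of the basis vector `e k w`. -/
def e (k : ℕ) (w : Perm (Fin (n + 1))) : D.Ind :=
  Submodule.mkQ (Submodule.span C D.relSet) (Finsupp.single (k, w) 1)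

theorem σ_smul_e (g : Perm (Fin n)) (k : ℕ) (w : Perm (Fin (n + 1))) :
    D.σ g • D.e k w = D.e k (extendPerm n g * w) := by
  rw [← sub_eq_zero, e, e, ← map_smul, ← map_sub, Submodule.mkQ_apply,
    Submodule.Quotient.mk_eq_zero]
  exact Submodule.subset_span (Or.inl ⟨k, g, w, rfl⟩)

theorem sum_e (k : ℕ) (w : Perm (Fin (n + 1))) :
    (p.sum fun l a => algebraMap R C a • D.e (k + l) w) = 0 := by
  have : Submodule.mkQ (Submodule.span C D.relSet)
      (p.sum fun l a => algebraMap R C a • Finsupp.single (k + l, w) 1) = 0 := by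
    rw [Submodule.mkQ_apply, Submodule.Quotient.mk_eq_zero]
    exact Submodule.subset_span (Or.inr ⟨k, w, rfl⟩)
  simp only [Polynomial.sum, map_sum, map_smul] at this
  exact this

variable {D} in
theorem hom_ext {M : Type*} [AddCommGroup M] [Module C M] {f g : D.Ind →ₗ[C] M}
    (h : ∀ k w, f (D.e k w) = g (D.e k w)) : f = g := by
  refine Submodule.linearMap_qext _ (Finsupp.lhom_ext' fun x => LinearMap.ext_ring ?_)
  exact h x.1 x.2

/-- The universal property of the induced module. -/
def lift {M : Type*} [AddCommGroup M] [Module C M] (f : ℕ → Perm (Fin (n + 1)) → M)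
    (h1 : ∀ g k w, D.σ g • f k w = f k (extendPerm n g * w))
    (h2 : ∀ k w, (p.sum fun l a => algebraMap R C a • f (k + l) w) = 0) : D.Ind →ₗ[C] M :=
  Submodule.liftQ _ (Finsupp.linearCombination C fun x => f x.1 x.2) <| by
    refine Submodule.span_le.2 ?_
    rintro _ (⟨k, g, w, rfl⟩ | ⟨k, w, rfl⟩)
    · simp [h1]
    · simpa [Polynomial.sum, map_sum, Algebra.algebraMap_eq_smul_one] using h2 k w

@[simp] theorem lift_e {M : Type*} [AddCommGroup M] [Module C M] (f : ℕ → Perm (Fin (n + 1)) → M)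
    (h1 h2) (k : ℕ) (w : Perm (Fin (n + 1))) : D.lift f h1 h2 (D.e k w) = f k w := by
  simp [lift, e]

/-- Right multiplication by a permutation. -/
def permEnd (v : Perm (Fin (n + 1))) : Module.End C D.Ind :=
  D.lift (fun k w => D.e k (w * v)) (fun g k w => by rw [D.σ_smul_e, mul_assoc])
    fun k w => D.sum_e k (w * v)

@[simp] theorem permEnd_e (v : Perm (Fin (n + 1))) (k : ℕ) (w : Perm (Fin (n + 1))) :
    D.permEnd v (D.e k w) = D.e k (w * v) := D.lift_e ..

/-- Right multiplication of `e k w` by `t_i`. -/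
def tAct (i : Fin (n + 1)) (k : ℕ) (w : Perm (Fin (n + 1))) : D.Ind :=
  -- Since `t_{n+1}^k w t_i = t_{n+1}^k t_{w i} w`, the power grows if `w i` is the last letter. For
  -- `w i = a`, use `t_{n+1}^k t_a = t_a t_{n+1}^k + (t_a^k - t_{n+1}^k) (a, n+1)`.
  Fin.lastCases (motive := fun _ => D.Ind) (D.e (k + 1) w)
    (fun a => D.t a • D.e k w - D.e k (swap a.castSucc (Fin.last n) * w) +
      D.t a ^ k • D.e 0 (swap a.castSucc (Fin.last n) * w)) (w i)

theorem tAct_last {i : Fin (n + 1)} {w : Perm (Fin (n + 1))} (h : w i = Fin.last n) (k : ℕ) :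
    D.tAct i k w = D.e (k + 1) w := by
  rw [tAct, h, Fin.lastCases_last]

theorem tAct_castSucc {i : Fin (n + 1)} {w : Perm (Fin (n + 1))} {a : Fin n}
    (h : w i = a.castSucc) (k : ℕ) :
    D.tAct i k w = D.t a • D.e k w - D.e k (swap a.castSucc (Fin.last n) * w) +
      D.t a ^ k • D.e 0 (swap a.castSucc (Fin.last n) * w) := by
  rw [tAct, h, Fin.lastCases_castSucc]

theorem conj_pow (w : Perm (Fin n)) (i : Fin n) (k : ℕ) :
    D.σ w * D.t i ^ k = D.t (w i) ^ k * D.σ w :=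
  ((show SemiconjBy (D.σ w) (D.t i) (D.t (w i)) from D.conj w i).pow_right k).eq

theorem swap_mul_extendPerm (g : Perm (Fin n)) (a : Fin n) :
    swap (g a).castSucc (Fin.last n) * extendPerm n g =
      extendPerm n g * swap a.castSucc (Fin.last n) := by
  rw [← extendPerm_castSucc, Equiv.mul_swap_eq_swap_mul, extendPerm_last]

theorem cases_last (x : Fin (n + 1)) : x = Fin.last n ∨ ∃ a : Fin n, x = a.castSucc :=
  Fin.lastCases (Or.inl rfl) (fun a => Or.inr ⟨a, rfl⟩) x

/-- Right multiplication by `t_i`. -/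
def tEnd (i : Fin (n + 1)) : Module.End C D.Ind :=
  D.lift (D.tAct i)
    (fun g k w => by
      obtain h | ⟨a, h⟩ := cases_last (w i)
      · rw [D.tAct_last h, D.tAct_last (by simp [h]), D.σ_smul_e]
      · rw [D.tAct_castSucc h, D.tAct_castSucc (a := g a) (by simp [h]), ← mul_assoc,
          swap_mul_extendPerm, mul_assoc, ← D.σ_smul_e, ← D.σ_smul_e, ← D.σ_smul_e]
        simp only [smul_add, smul_sub, smul_smul, D.conj, conj_pow])
    (fun k w => by
      obtain h | ⟨a, h⟩ := cases_last (w i)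
      · simp only [D.tAct_last h]
        simpa only [add_right_comm] using D.sum_e (k + 1) w
      · simp only [D.tAct_castSucc h]
        -- The three terms of `tAct` vanish separately: the first two by the relation in the module,
        -- the third because `t a` is a root of `p` in `C`.
        have h1 := congrArg (D.t a • ·) (D.sum_e k w)
        have h2 := D.sum_e k (swap a.castSucc (Fin.last n) * w)
        have h3 := congrArg (fun x => (D.t a ^ k * x) •
          D.e 0 (swap a.castSucc (Fin.last n) * w)) (D.sum_t a)
        simp only [Polynomial.sum, Finset.smul_sum, Finset.mul_sum,
          Finset.sum_smul, smul_zero, mul_zero, zero_smul, smul_smul] at h1 h2 h3 ⊢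
        simp only [smul_add, smul_sub, smul_smul, Finset.sum_add_distrib, Finset.sum_sub_distrib,
          h2, sub_zero, ← Algebra.commutes] at h1 ⊢
        rw [h1, zero_add, ← h3]
        refine Finset.sum_congr rfl fun l _ => ?_
        rw [← mul_assoc, ← Algebra.commutes, mul_assoc, pow_add])

@[simp] theorem tEnd_e (i : Fin (n + 1)) (k : ℕ) (w : Perm (Fin (n + 1))) :
    D.tEnd i (D.e k w) = D.tAct i k w := D.lift_e ..

theorem tEnd_e_last {i : Fin (n + 1)} {w : Perm (Fin (n + 1))} (h : w i = Fin.last n) (k : ℕ) :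
    D.tEnd i (D.e k w) = D.e (k + 1) w := by rw [tEnd_e, D.tAct_last h]

theorem tEnd_e_castSucc {i : Fin (n + 1)} {w : Perm (Fin (n + 1))} {a : Fin n}
    (h : w i = a.castSucc) (k : ℕ) :
    D.tEnd i (D.e k w) = D.t a • D.e k w - D.e k (swap a.castSucc (Fin.last n) * w) +
      D.t a ^ k • D.e 0 (swap a.castSucc (Fin.last n) * w) := by
  rw [tEnd_e, D.tAct_castSucc h]

theorem tEnd_e_zero {i : Fin (n + 1)} {w : Perm (Fin (n + 1))} {a : Fin n}
    (h : w i = a.castSucc) : D.tEnd i (D.e 0 w) = D.t a • D.e 0 w := by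
  rw [D.tEnd_e_castSucc h, pow_zero, one_smul, sub_add_cancel]

theorem permEnd_mul (v w : Perm (Fin (n + 1))) :
    D.permEnd (v * w) = D.permEnd w * D.permEnd v :=
  hom_ext fun k x => by simp [mul_assoc]

theorem tEnd_mul_permEnd (v : Perm (Fin (n + 1))) (i : Fin (n + 1)) :
    D.tEnd i * D.permEnd v = D.permEnd v * D.tEnd (v i) := by
  refine hom_ext fun k w => ?_
  simp only [Module.End.mul_apply, permEnd_e]
  obtain h | ⟨a, h⟩ := cases_last (w (v i))
  · rw [D.tEnd_e_last h, D.tEnd_e_last (by simp [h]), permEnd_e]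
  · rw [D.tEnd_e_castSucc h, D.tEnd_e_castSucc (a := a) (by simp [h])]
    simp [mul_assoc]

/-- When `w i` is the last letter, multiplying `w` on the left by the transposition of `b` and the
last letter equals multiplying on the right by `swap i j`; all terms then match. -/
theorem tEnd_mul_comm_aux {i j : Fin (n + 1)} {k : ℕ} {w : Perm (Fin (n + 1))}
    (h : w i = Fin.last n) {b : Fin n} (h' : w j = b.castSucc) :
    D.tEnd j (D.tEnd i (D.e k w)) = D.tEnd i (D.tEnd j (D.e k w)) +
      D.permEnd (swap i j) (D.tEnd j (D.e k w) - D.tEnd i (D.e k w)) := by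
  have h1 : (swap b.castSucc (Fin.last n) * w) i = b.castSucc := by simp [h]
  have h2 : swap b.castSucc (Fin.last n) * w = w * swap i j := by
    rw [Equiv.mul_swap_eq_swap_mul, h, h', swap_comm]
  have h3 : swap b.castSucc (Fin.last n) * (swap b.castSucc (Fin.last n) * w) = w := by simp
  rw [D.tEnd_e_last h, D.tEnd_e_castSucc h', D.tEnd_e_castSucc h']
  simp only [map_add, map_sub, map_smul, D.tEnd_e_last h, D.tEnd_e_castSucc h1, h3, permEnd_e]
  simp only [h2, mul_assoc, swap_mul_self, mul_one, pow_zero, one_smul, smul_add, smul_sub,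
    smul_smul, ← pow_succ]
  abel

theorem comm_pow {a b : Fin n} (hab : a ≠ b) (k : ℕ) :
    D.t a ^ k * D.t b = D.t b * D.t a ^ k + (D.t b ^ k - D.t a ^ k) * D.σ (swap a b) :=
  pow_mul_of_comm (D.comm a b hab) (by simpa using D.conj (swap a b) a) k

theorem tEnd_mul_comm {i j : Fin (n + 1)} (hij : i ≠ j) :
    D.tEnd j * D.tEnd i = D.tEnd i * D.tEnd j +
      D.permEnd (swap i j) * (D.tEnd j - D.tEnd i) := by
  refine hom_ext fun k w => ?_
  simp only [Module.End.mul_apply, LinearMap.add_apply, LinearMap.sub_apply]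
  obtain h | ⟨a, h⟩ := cases_last (w i)
  · obtain h' | ⟨b, h'⟩ := cases_last (w j)
    · exact absurd (w.injective (h.trans h'.symm)) hij
    · exact D.tEnd_mul_comm_aux h h'
  · obtain h' | ⟨b, h'⟩ := cases_last (w j)
    · have := D.tEnd_mul_comm_aux (k := k) h' h
      rw [this, swap_comm, ← neg_sub, map_neg]
      abel
    · have hab : a ≠ b := by
        rintro rfl
        exact hij (w.injective (h.trans h'.symm))
      have hab' : a.castSucc ≠ b.castSucc := fun e => hab (Fin.castSucc_injective n e)
      have ha := (Fin.castSucc_lt_last a).ne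
      have hb := (Fin.castSucc_lt_last b).ne
      -- Here neither letter is last. The permutation identities below bring `(a, b)` to the front,
      -- where it becomes a scalar from `C`; what remains is `comm` and its powers in `C`.
      have h1 : (swap a.castSucc (Fin.last n) * w) j = b.castSucc := by
        simp [h', swap_apply_of_ne_of_ne hab'.symm hb]
      have h2 : (swap b.castSucc (Fin.last n) * w) i = a.castSucc := by
        simp [h, swap_apply_of_ne_of_ne hab' ha]
      have h3 : w * swap i j = extendPerm n (swap a b) * w := by
        rw [Equiv.mul_swap_eq_swap_mul, h, h', extendPerm_swap]
      have h4 : swap b.castSucc (Fin.last n) * (swap a.castSucc (Fin.last n) * w) =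
          extendPerm n (swap a b) * (swap b.castSucc (Fin.last n) * w) := by
        rw [← mul_assoc, Equiv.mul_swap_eq_swap_mul, swap_apply_right,
          swap_apply_of_ne_of_ne hab' ha, extendPerm_swap, mul_assoc]
      have h5 : swap a.castSucc (Fin.last n) * (swap b.castSucc (Fin.last n) * w) =
          extendPerm n (swap a b) * (swap a.castSucc (Fin.last n) * w) := by
        rw [← mul_assoc, Equiv.mul_swap_eq_swap_mul, swap_apply_right,
          swap_apply_of_ne_of_ne hab'.symm hb, extendPerm_swap, mul_assoc, swap_comm b.castSucc]
      have h6 : swap a.castSucc (Fin.last n) * (extendPerm n (swap a b) * w) =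
          extendPerm n (swap a b) * (swap b.castSucc (Fin.last n) * w) := by
        rw [← mul_assoc, ← mul_assoc, ← swap_mul_extendPerm, swap_apply_right]
      have h7 : swap b.castSucc (Fin.last n) * (extendPerm n (swap a b) * w) =
          extendPerm n (swap a b) * (swap a.castSucc (Fin.last n) * w) := by
        rw [← mul_assoc, ← mul_assoc, ← swap_mul_extendPerm, swap_apply_left]
      have c1 := D.comm a b hab
      have c2 := D.comm_pow hab k
      have c3 := D.comm_pow hab.symm k
      rw [swap_comm b a] at c3
      rw [D.tEnd_e_castSucc h, D.tEnd_e_castSucc h']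
      simp only [map_add, map_sub, map_smul, D.tEnd_e_castSucc h, D.tEnd_e_castSucc h',
        D.tEnd_e_castSucc h1, D.tEnd_e_castSucc h2, permEnd_e]
      simp only [mul_assoc, h3, h4, h5, h6, h7]
      simp only [← D.σ_smul_e, smul_add, smul_sub, smul_smul, c1, c2, c3, add_smul, sub_smul,
        pow_zero, one_mul, sub_mul]
      abel

end WreathRep
end DegHecke

/-! ### The cyclotomic relation and the induced representation -/

namespace DegHecke

open Polynomial Equiv

theorem aeval_op {R A : Type*} [CommRing R] [Ring A] [Algebra R A] (x : A) (q : R[X]) :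
    aeval (MulOpposite.op x) q = MulOpposite.op (aeval x q) := by
  induction q using Polynomial.induction_on' with
  | add q r hq hr => rw [map_add, map_add, hq, hr, MulOpposite.op_add]
  | monomial k a =>
    rw [aeval_monomial, aeval_monomial, Algebra.commutes a (x ^ k), MulOpposite.op_mul,
      MulOpposite.op_pow, MulOpposite.algebraMap_apply]

variable {R : Type} [CommRing R]

namespace WreathRep

variable {p : R[X]} {n : ℕ} {C : Type} [Ring C] [Algebra R C] (D : WreathRep p n C)

theorem aeval_tEnd_apply_e_of_last {i : Fin (n + 1)} {w : Perm (Fin (n + 1))}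
    (h : w i = Fin.last n) (k : ℕ) : aeval (D.tEnd i) p (D.e k w) = 0 := by
  have hpow : ∀ l, (D.tEnd i ^ l) (D.e k w) = D.e (k + l) w := by
    intro l
    induction l with
    | zero => simp
    | succ l ih => rw [pow_succ', Module.End.mul_apply, ih, D.tEnd_e_last h, add_assoc]
  rw [aeval_def, eval₂_eq_sum, ← D.sum_e k w]
  simp only [Polynomial.sum, LinearMap.sum_apply, Module.End.mul_apply, hpow,
    Module.algebraMap_end_apply, algebraMap_smul]

theorem aeval_tEnd_apply_e_zero {i : Fin (n + 1)} {w : Perm (Fin (n + 1))} {a : Fin n}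
    (h : w i = a.castSucc) : aeval (D.tEnd i) p (D.e 0 w) = 0 := by
  have hpow : ∀ l, (D.tEnd i ^ l) (D.e 0 w) = D.t a ^ l • D.e 0 w := by
    intro l
    induction l with
    | zero => simp
    | succ l ih =>
      rw [pow_succ', Module.End.mul_apply, ih, map_smul, D.tEnd_e_zero h, smul_smul, pow_succ]
  have := congrArg (· • D.e 0 w) (D.sum_t a)
  rw [aeval_def, eval₂_eq_sum]
  simp only [Polynomial.sum, LinearMap.sum_apply, Module.End.mul_apply, hpow,
    Module.algebraMap_end_apply, zero_smul, Finset.sum_smul, mul_smul, algebraMap_smul] at this ⊢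
  exact this

/-- On `e k w` with `w i` last this is the defining relation of the module; on `e 0 w` with `w i =
a` it is `p(t_a) = 0` in `C`. Larger `k` are reached by a right multiplication past which `p(t_i)`
can be moved. -/
theorem aeval_tEnd (i : Fin (n + 1)) : aeval (D.tEnd i) p = 0 := by
  refine hom_ext fun k w => ?_
  rw [LinearMap.zero_apply]
  obtain h | ⟨a, h⟩ := cases_last (w i)
  · exact D.aeval_tEnd_apply_e_of_last h k
  · induction k with
    | zero => exact D.aeval_tEnd_apply_e_zero h
    | succ k ih =>
      -- This `j` is chosen so that `t_j` takes `e k w` to `e (k + 1) w`.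
      set j := w⁻¹ (Fin.last n) with hj
      have hwj : w j = Fin.last n := by simp [hj]
      have hij : i ≠ j := by
        rintro rfl
        rw [hwj] at h
        exact (Fin.castSucc_lt_last a).ne h.symm
      have key : D.tEnd j * aeval (D.tEnd i) p = aeval (D.tEnd i) p * D.tEnd j +
          D.permEnd (swap i j) * (aeval (D.tEnd j) p - aeval (D.tEnd i) p) := by
        have := aeval_mul_of_comm (x := MulOpposite.op (D.tEnd i)) (y := MulOpposite.op (D.tEnd j))
          (s := MulOpposite.op (D.permEnd (swap i j)))
          (congrArg MulOpposite.op (D.tEnd_mul_comm hij))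
          (congrArg MulOpposite.op (by simpa using D.tEnd_mul_permEnd (swap i j) i)) p
        simp only [aeval_op] at this
        have := congrArg MulOpposite.unop this
        simpa [mul_sub, mul_add] using this
      have := congrArg (fun f => f (D.e k w)) key
      simpa [D.tEnd_e_last hwj, ih, D.aeval_tEnd_apply_e_of_last hwj] using this.symm

/-- The algebra acting on the induced module from the right. -/
abbrev IndEnd : Type := (Module.End C D.Ind)ᵐᵒᵖ

/-- Induction from `n` to `n + 1` letters. -/
def ind : WreathRep p (n + 1) D.IndEnd where
  σ :=
    { toFun := fun w => MulOpposite.op (D.permEnd w)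
      map_one' := by
        rw [← MulOpposite.op_one]
        exact congrArg MulOpposite.op (hom_ext fun k w => by simp)
      map_mul' := fun v w => by rw [permEnd_mul, MulOpposite.op_mul] }
  t i := MulOpposite.op (D.tEnd i)
  conj w i := congrArg MulOpposite.op (D.tEnd_mul_permEnd w i)
  comm i j hij := congrArg MulOpposite.op (D.tEnd_mul_comm hij)
  aeval_t i := by
    rw [aeval_op, aeval_tEnd, MulOpposite.op_zero]

variable {D} in
/-- `x` acts on the `C`-module through `c`. -/
structure ActsAs (φ : D.Ind →ₗ[C] C) (x : D.IndEnd) (c : C) : Prop where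
  row : x.unop (D.e 0 1) = c • D.e 0 1
  col : ∀ y, φ (x.unop y) = φ y * c

section phi

variable (lam : ℕ → R) (hlam : ∀ k, (p.sum fun l a => a * lam (k + l)) = 0)

open Classical in
/-- The values of `phi` on the symbols `e k w`. -/
def phiFun (k : ℕ) (w : Perm (Fin (n + 1))) : C :=
  if h : ∃ g, extendPerm n g = w then lam k • D.σ h.choose else 0

theorem phiFun_extendPerm (k : ℕ) (g : Perm (Fin n)) :
    D.phiFun lam k (extendPerm n g) = lam k • D.σ g := by
  have h : ∃ g', extendPerm n g' = extendPerm n g := ⟨g, rfl⟩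
  rw [phiFun, dif_pos h, extendPerm_injective n h.choose_spec]

theorem phiFun_of_not {w : Perm (Fin (n + 1))} (h : w ∉ (extendPerm n).range) (k : ℕ) :
    D.phiFun lam k w = 0 := dif_neg h

theorem notMem_range {w : Perm (Fin (n + 1))} (i : Fin n) (h : w i.castSucc = Fin.last n) :
    w ∉ (extendPerm n).range := by
  rintro ⟨g, rfl⟩
  rw [extendPerm_castSucc] at h
  exact (Fin.castSucc_lt_last _).ne h

/-- The coefficient at the identity, where `e k 1` counts as `lam k`. -/
def phi : D.Ind →ₗ[C] C :=
  D.lift (D.phiFun lam)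
    (fun g k w => by
      by_cases h : w ∈ (extendPerm n).range
      · obtain ⟨v, rfl⟩ := h
        rw [← map_mul, phiFun_extendPerm, phiFun_extendPerm, map_mul, smul_eq_mul, mul_smul_comm]
      · rw [D.phiFun_of_not lam h, D.phiFun_of_not lam, smul_zero]
        rwa [Subgroup.mul_mem_cancel_left _ (MonoidHom.mem_range.2 ⟨g, rfl⟩)])
    (fun k w => by
      by_cases h : w ∈ (extendPerm n).range
      · obtain ⟨v, rfl⟩ := h
        have := congrArg (· • D.σ v) (hlam k)
        simp only [Polynomial.sum, Finset.sum_smul, zero_smul] at this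
        simpa only [phiFun_extendPerm, Polynomial.sum, algebraMap_smul, smul_smul] using this
      · simp only [D.phiFun_of_not lam h, smul_zero, Polynomial.sum, Finset.sum_const_zero])

theorem phi_e_extendPerm (k : ℕ) (g : Perm (Fin n)) :
    D.phi lam hlam (D.e k (extendPerm n g)) = lam k • D.σ g := by
  rw [phi, lift_e, phiFun_extendPerm]

theorem phi_e_of_not {w : Perm (Fin (n + 1))} (h : w ∉ (extendPerm n).range) (k : ℕ) :
    D.phi lam hlam (D.e k w) = 0 := by
  rw [phi, lift_e, D.phiFun_of_not lam h]

theorem phi_permEnd (g : Perm (Fin n)) (x : D.Ind) :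
    D.phi lam hlam (D.permEnd (extendPerm n g) x) = D.phi lam hlam x * D.σ g := by
  refine congrArg (fun f : D.Ind →ₗ[C] C => f x) (hom_ext
    (f := D.phi lam hlam ∘ₗ D.permEnd (extendPerm n g)) (g := LinearMap.toSpanSingleton C C (D.σ g) ∘ₗ D.phi lam hlam) fun k w => ?_)
  simp only [LinearMap.comp_apply, permEnd_e, LinearMap.toSpanSingleton_apply, smul_eq_mul]
  by_cases h : w ∈ (extendPerm n).range
  · obtain ⟨v, rfl⟩ := h
    rw [← map_mul, phi_e_extendPerm, phi_e_extendPerm, map_mul, smul_mul_assoc]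
  · rw [D.phi_e_of_not lam hlam h, D.phi_e_of_not lam hlam, zero_mul]
    rwa [Subgroup.mul_mem_cancel_right _ (MonoidHom.mem_range.2 ⟨g, rfl⟩)]

/-- The correction terms in `tAct` carry a permutation sending `i` to the last letter; it lies
outside the smaller symmetric group, so `phi` kills them. -/
theorem phi_tEnd (i : Fin n) (x : D.Ind) :
    D.phi lam hlam (D.tEnd i.castSucc x) = D.phi lam hlam x * D.t i := by
  refine congrArg (fun f : D.Ind →ₗ[C] C => f x) (hom_ext
    (f := D.phi lam hlam ∘ₗ D.tEnd i.castSucc) (g := LinearMap.toSpanSingleton C C (D.t i) ∘ₗ D.phi lam hlam) fun k w => ?_)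
  simp only [LinearMap.comp_apply, LinearMap.toSpanSingleton_apply, smul_eq_mul]
  obtain h | ⟨a, h⟩ := cases_last (w i.castSucc)
  · rw [D.tEnd_e_last h, D.phi_e_of_not _ _ (notMem_range i h),
      D.phi_e_of_not _ _ (notMem_range i h), zero_mul]
  · rw [D.tEnd_e_castSucc h]
    have h' : swap a.castSucc (Fin.last n) * w ∉ (extendPerm n).range :=
      notMem_range i (by simp [h])
    rw [map_add, map_sub, map_smul, map_smul, D.phi_e_of_not _ _ h', D.phi_e_of_not _ _ h',
      smul_zero, sub_zero, add_zero, smul_eq_mul]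
    by_cases hw : w ∈ (extendPerm n).range
    · obtain ⟨v, rfl⟩ := hw
      have : v i = a := Fin.castSucc_injective n (by simpa using h)
      rw [phi_e_extendPerm, smul_mul_assoc, D.conj, this, mul_smul_comm]
    · rw [D.phi_e_of_not _ _ hw, mul_zero, zero_mul]

theorem actsAs_σ (g : Perm (Fin n)) :
    ActsAs (D.phi lam hlam) (D.ind.σ (extendPerm n g)) (D.σ g) where
  row := by
    change D.permEnd _ _ = _
    rw [permEnd_e, σ_smul_e, one_mul, mul_one]
  col := D.phi_permEnd lam hlam g

theorem actsAs_t (i : Fin n) : ActsAs (D.phi lam hlam) (D.ind.t i.castSucc) (D.t i) where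
  row := D.tEnd_e_zero rfl
  col := D.phi_tEnd lam hlam i

end phi

namespace ActsAs

variable {D} {φ : D.Ind →ₗ[C] C} {x y : D.IndEnd} {c d : C}

theorem mul (hx : ActsAs φ x c) (hy : ActsAs φ y d) : ActsAs φ (x * y) (c * d) where
  row := by
    rw [MulOpposite.unop_mul, Module.End.mul_apply, hx.row, map_smul, hy.row, smul_smul]
  col z := by
    rw [MulOpposite.unop_mul, Module.End.mul_apply, hy.col, hx.col, mul_assoc]

theorem add (hx : ActsAs φ x c) (hy : ActsAs φ y d) : ActsAs φ (x + y) (c + d) where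
  row := by
    rw [MulOpposite.unop_add, LinearMap.add_apply, hx.row, hy.row, add_smul]
  col z := by
    rw [MulOpposite.unop_add, LinearMap.add_apply, map_add, hy.col, hx.col, mul_add]

theorem scalar (r : R) : ActsAs φ (algebraMap R D.IndEnd r) (algebraMap R C r) where
  row := by
    change (algebraMap R (Module.End C D.Ind) r) _ = _
    rw [Module.algebraMap_end_apply, algebraMap_smul]
  col z := by
    change φ ((algebraMap R (Module.End C D.Ind) r) _) = _
    rw [Module.algebraMap_end_apply, ← algebraMap_smul C, map_smul, smul_eq_mul, Algebra.commutes]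

end ActsAs

end WreathRep
end DegHecke

/-! ### Matrix coefficients, the action of the Hecke algebra, and the models -/

namespace DegHecke

open Polynomial Equiv

theorem swap_braid {α : Type*} [DecidableEq α] {a b c : α} (hab : a ≠ b) (hac : a ≠ c)
    (hbc : b ≠ c) : swap a b * swap b c * swap a b = swap b c * swap a b * swap b c := by
  rw [mul_swap_eq_swap_mul (swap a b) b c, swap_apply_right,
    swap_apply_of_ne_of_ne hac.symm hbc.symm, mul_assoc, swap_mul_self,
    mul_swap_eq_swap_mul (swap b c) a b, swap_apply_left, swap_apply_of_ne_of_ne hab hac,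
    mul_assoc, swap_mul_self]

variable {R : Type} [CommRing R]

namespace WreathRep

section coeff

variable {p : R[X]} {n : ℕ} {C : Type} [Ring C] [Algebra R C] (D : WreathRep p n C)
variable (lam : ℕ → R) (hlam : ∀ k, (p.sum fun l a => a * lam (k + l)) = 0)

/-- The matrix coefficient at `e 0 1`. -/
def coeff : D.IndEnd →ₗ[R] C where
  toFun x := D.phi lam hlam (x.unop (D.e 0 1))
  map_add' x y := by rw [MulOpposite.unop_add, LinearMap.add_apply, map_add]
  map_smul' r x := by
    rw [MulOpposite.unop_smul, LinearMap.smul_apply, ← algebraMap_smul C, map_smul,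
      RingHom.id_apply, algebraMap_smul]

/-- Together with `coeff_mul_right`, this makes `coeff` behave as a conditional expectation from `n
+ 1` letters to `n`. -/
theorem coeff_mul_left {x : D.IndEnd} {c : C} (h : ActsAs (D.phi lam hlam) x c) (y : D.IndEnd) :
    D.coeff lam hlam (x * y) = c * D.coeff lam hlam y := by
  change D.phi lam hlam (y.unop (x.unop _)) = c * D.phi lam hlam (y.unop _)
  rw [h.row, map_smul, map_smul, smul_eq_mul]

theorem coeff_mul_right {x : D.IndEnd} {c : C} (h : ActsAs (D.phi lam hlam) x c) (y : D.IndEnd) :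
    D.coeff lam hlam (y * x) = D.coeff lam hlam y * c := h.col _

theorem e_zero_mul_t_last_pow (k : ℕ) :
    (D.ind.t (Fin.last n) ^ k).unop (D.e 0 1) = D.e k 1 := by
  induction k with
  | zero => simp
  | succ k ih =>
    rw [pow_succ, MulOpposite.unop_mul, Module.End.mul_apply, ih]
    exact D.tEnd_e_last rfl k

theorem coeff_t_last_pow_mul_σ (k : ℕ) (w : Perm (Fin (n + 1))) :
    D.coeff lam hlam (D.ind.t (Fin.last n) ^ k * D.ind.σ w) = D.phi lam hlam (D.e k w) := by
  change D.phi lam hlam (D.permEnd w ((D.ind.t (Fin.last n) ^ k).unop (D.e 0 1))) = _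
  rw [e_zero_mul_t_last_pow, permEnd_e, one_mul]

theorem coeff_t_last_pow (k : ℕ) :
    D.coeff lam hlam (D.ind.t (Fin.last n) ^ k) = lam k • (1 : C) := by
  have := D.coeff_t_last_pow_mul_σ lam hlam k (extendPerm n 1)
  rwa [phi_e_extendPerm, map_one, map_one, map_one, mul_one] at this

theorem coeff_σ_of_not {w : Perm (Fin (n + 1))} (h : w ∉ (extendPerm n).range) :
    D.coeff lam hlam (D.ind.σ w) = 0 := by
  have := D.coeff_t_last_pow_mul_σ lam hlam 0 w
  rwa [D.phi_e_of_not lam hlam h, pow_zero, one_mul] at this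

end coeff

section toAlg

variable {m : ℕ} {u : Fin m → R} {n : ℕ} {C : Type} [Ring C] [Algebra R C]
  (D : WreathRep (∏ j, (X - Polynomial.C (u j))) n C)

theorem σ_adjSwap_mul_self (i : SimpleIdx n) : D.σ (adjSwap i) * D.σ (adjSwap i) = 1 := by
  rw [← map_mul, adjSwap, swap_mul_self, map_one]

/-- The images of the generators of the Hecke algebra. -/
def genMap (hn : 0 < n) : Gen n → C
  | .t => D.t ⟨0, hn⟩
  | .s i => D.σ (adjSwap i)

/-- The homomorphism from the Hecke algebra with `t ↦ t_1`. -/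
def toAlg (hn : 0 < n) : Hecke u n →ₐ[R] C :=
  RingQuot.liftAlgHom R ⟨FreeAlgebra.lift R (D.genMap hn), by
    intro x y hxy
    cases hxy with
    | cyclotomic =>
      have := D.aeval_t ⟨0, hn⟩
      simp only [← List.prod_ofFn] at this
      simpa [map_list_prod, List.map_ofFn, Function.comp_def, genMap] using this
    | t_s_one i hi =>
      have h1 : adjSwap i ⟨0, hn⟩ = ⟨1, hi ▸ i.2.2⟩ := by
        simp [adjSwap, hi]
      have h2 : adjSwap i = swap ⟨0, hn⟩ ⟨1, hi ▸ i.2.2⟩ := by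
        simp [adjSwap, hi]
      -- For the first two letters `comm` reads `t t_2 = t_2 t + (t_2 - t) s_1`, which is the
      -- required relation once `s_1 t = t_2 s_1` is used.
      have c := D.comm ⟨0, hn⟩ ⟨1, hi ▸ i.2.2⟩ (by simp)
      rw [← h2] at c
      have e1 := D.conj (adjSwap i) ⟨0, hn⟩
      rw [h1] at e1
      have e2 : D.σ (adjSwap i) * D.t ⟨0, hn⟩ * D.σ (adjSwap i) = D.t ⟨1, hi ▸ i.2.2⟩ := by
        rw [e1, mul_assoc, σ_adjSwap_mul_self, mul_one]
      simp only [map_mul, map_add, FreeAlgebra.lift_ι_apply, genMap]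
      rw [e2, mul_add, c, add_mul, e1]
      noncomm_ring
    | t_s i hi =>
      have h1 : adjSwap i ⟨0, hn⟩ = ⟨0, hn⟩ :=
        swap_apply_of_ne_of_ne (by simp; omega) (by simp; omega)
      have e1 := D.conj (adjSwap i) ⟨0, hn⟩
      rw [h1] at e1
      simpa only [map_mul, FreeAlgebra.lift_ι_apply, genMap] using e1.symm
    | s_sq i =>
      simpa only [map_mul, map_one, FreeAlgebra.lift_ι_apply, genMap] using D.σ_adjSwap_mul_self i
    | braid i j hij =>
      simp only [map_mul, FreeAlgebra.lift_ι_apply, genMap]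
      rw [← map_mul, ← map_mul, ← map_mul, ← map_mul]
      congr 1
      obtain ⟨i, hi⟩ := i
      obtain ⟨j, hj⟩ := j
      obtain rfl : j = i + 1 := hij
      have a1 : (⟨i - 1, by omega⟩ : Fin n) ≠ ⟨i, by omega⟩ := by simp; omega
      have a2 : (⟨i - 1, by omega⟩ : Fin n) ≠ ⟨i + 1, by omega⟩ := by simp
      have a3 : (⟨i, by omega⟩ : Fin n) ≠ ⟨i + 1, by omega⟩ := by simp
      simp only [adjSwap, add_tsub_cancel_right]
      exact swap_braid a1 a2 a3
    | s_comm i j hij =>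
      simp only [map_mul, FreeAlgebra.lift_ι_apply, genMap]
      rw [← map_mul, ← map_mul]
      congr 1
      refine (Perm.Disjoint.commute ?_).eq
      obtain ⟨i, hi⟩ := i
      obtain ⟨j, hj⟩ := j
      change i + 1 < j ∨ j + 1 < i at hij
      simp only [adjSwap]
      rw [Perm.disjoint_iff_eq_or_eq]
      intro x
      by_cases hx : (x : ℕ) = i - 1 ∨ (x : ℕ) = i
      · right
        exact swap_apply_of_ne_of_ne (by simp [Fin.ext_iff]; omega) (by simp [Fin.ext_iff]; omega)
      · left
        exact swap_apply_of_ne_of_ne (by simp [Fin.ext_iff]; omega) (by simp [Fin.ext_iff]; omega)⟩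

theorem toAlg_quot_ι (hn : 0 < n) (g : Gen n) :
    D.toAlg hn (quot u n (FreeAlgebra.ι R g)) = D.genMap hn g := by
  unfold toAlg quot
  erw [RingQuot.liftAlgHom_mkAlgHom_apply]
  rw [FreeAlgebra.lift_ι_apply]

theorem toAlg_S (hn : 0 < n) (i : SimpleIdx n) : D.toAlg hn (S u i) = D.σ (adjSwap i) :=
  D.toAlg_quot_ι hn (Gen.s i)

theorem toAlg_tElt (hn : 0 < n) (k : ℕ) (hk : k < n) :
    D.toAlg hn (tElt u n k hk) = D.t ⟨k, hk⟩ := by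
  induction k with
  | zero => exact D.toAlg_quot_ι hn Gen.t
  | succ k ih =>
    have h : adjSwap (⟨k + 1, Nat.succ_pos k, hk⟩ : SimpleIdx n) ⟨k, Nat.lt_of_succ_lt hk⟩ =
        ⟨k + 1, hk⟩ := by simp [adjSwap]
    rw [tElt, map_mul, map_mul, toAlg_S, ih, D.conj, h, mul_assoc, σ_adjSwap_mul_self, mul_one]

theorem toAlg_word (hn : 0 < n) (l : List (SimpleIdx n)) :
    D.toAlg hn (l.map (S u)).prod = D.σ (l.map adjSwap).prod := by
  rw [map_list_prod, map_list_prod, List.map_map, List.map_map]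
  exact congrArg (fun f => (l.map f).prod) (funext fun i => D.toAlg_S hn i)

end toAlg
end WreathRep

variable {m : ℕ} (u : Fin m → R)

theorem hecke_induction {n : ℕ} {P : Hecke u n → Prop} (hr : ∀ r, P (algebraMap R _ r))
    (hg : ∀ g, P (quot u n (FreeAlgebra.ι R g))) (hadd : ∀ x y, P x → P y → P (x + y))
    (hmul : ∀ x y, P x → P y → P (x * y)) (x : Hecke u n) : P x := by
  obtain ⟨y, rfl⟩ := RingQuot.mkAlgHom_surjective R (Rel u n) x
  change P (quot u n y)
  induction y using FreeAlgebra.induction with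
  | grade0 r => rw [AlgHom.commutes]; exact hr r
  | grade1 g => exact hg g
  | mul x y hx hy => rw [map_mul]; exact hmul _ _ hx hy
  | add x y hx hy => rw [map_add]; exact hadd _ _ hx hy

theorem extendPerm_adjSwap {n : ℕ} (i : SimpleIdx n) :
    extendPerm n (adjSwap i) = adjSwap ⟨i.1, i.2.1, Nat.lt_succ_of_lt i.2.2⟩ :=
  extendPerm_swap _ _

namespace WreathRep

variable {u} {n : ℕ} {C : Type} [Ring C] [Algebra R C]
  (D : WreathRep (∏ j, (X - Polynomial.C (u j))) n C)
  (lam : ℕ → R) (hlam : ∀ k, ((∏ j, (X - Polynomial.C (u j))).sum fun l a => a * lam (k + l)) = 0)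

/-- `ActsAs` is stable under sums and products and holds for scalars, so it is enough to check the
generators. -/
theorem actsAs_incl (hn : 0 < n) (x : Hecke u n) :
    ActsAs (D.phi lam hlam) (D.ind.toAlg (Nat.succ_pos n) (incl u (Nat.le_succ n) x))
      (D.toAlg hn x) := by
  refine hecke_induction u (P := fun x => ActsAs (D.phi lam hlam)
    (D.ind.toAlg (Nat.succ_pos n) (incl u (Nat.le_succ n) x)) (D.toAlg hn x)) (fun r => ?_) (fun g => ?_) (fun x y hx hy => ?_)
    (fun x y hx hy => ?_) x
  · simp only [AlgHom.commutes]
    exact ActsAs.scalar r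
  · rw [incl_quot_ι, toAlg_quot_ι, toAlg_quot_ι]
    cases g with
    | t => exact D.actsAs_t lam hlam ⟨0, hn⟩
    | s i =>
      have := D.actsAs_σ lam hlam (adjSwap i)
      rwa [extendPerm_adjSwap] at this
  · simp only [map_add]; exact hx.add hy
  · simp only [map_mul]; exact hx.mul hy

theorem adjSwap_notMem_range (hn : 0 < n) :
    adjSwap (⟨n, hn, Nat.lt_succ_self n⟩ : SimpleIdx (n + 1)) ∉ (extendPerm n).range := by
  refine notMem_range ⟨n - 1, by omega⟩ ?_
  exact swap_apply_left _ _

end WreathRep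

/-- A representation as in `WreathRep` together with a linear form. -/
structure Model (p : R[X]) (n : ℕ) where
  C : Type
  [ring : Ring C]
  [algebra : Algebra R C]
  rep : WreathRep p n C
  tr : C →ₗ[R] R

attribute [instance] Model.ring Model.algebra

/-- The models obtained by iterated induction from zero letters. -/
def model (p : R[X]) (lam : ℕ → R) (hlam : ∀ k, (p.sum fun l a => a * lam (k + l)) = 0) :
    ∀ n, Model p n
  | 0 =>
    { C := R
      rep :=
        { σ := 1
          t := fun i => i.elim0
          conj := fun _ i => i.elim0
          comm := fun i => i.elim0
          aeval_t := fun i => i.elim0 }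
      tr := LinearMap.id }
  | n + 1 =>
    { C := (model p lam hlam n).rep.IndEnd
      rep := (model p lam hlam n).rep.ind
      tr := (model p lam hlam n).tr ∘ₗ (model p lam hlam n).rep.coeff lam hlam }

/-- Under `coeff` the factors for the first `n` letters come out on the left as elements of `C`, and
`t_{n+1}^k w` becomes `lam k` times `w` if `w` fixes the last letter and `0` otherwise. This leaves
the same kind of word for `n` letters. -/
theorem model_tr_word {p : R[X]} {lam : ℕ → R}
    (hlam : ∀ k, (p.sum fun l a => a * lam (k + l)) = 0) (h0 : lam 0 = 1)
    (hm : ∀ k, 1 ≤ k → k < m → lam k = 0) (n : ℕ) (a : Fin n → ℕ) (ha : ∀ i, a i < m)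
    (w : Perm (Fin n)) :
    (model p lam hlam n).tr ((List.ofFn fun i => (model p lam hlam n).rep.t i ^ a i).prod *
      (model p lam hlam n).rep.σ w) = if (∀ i, a i = 0) ∧ w = 1 then 1 else 0 := by
  induction n with
  | zero =>
    rw [if_pos ⟨fun i => i.elim0, Subsingleton.elim _ _⟩]
    simp only [model, List.ofFn_zero]
    exact mul_one (1 : R)
  | succ n ih =>
    set D := (model p lam hlam n).rep with hD
    have hacts : ∀ l : List (Fin n), WreathRep.ActsAs (D.phi lam hlam)
        (l.map fun i => D.ind.t i.castSucc ^ a i.castSucc).prod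
        (l.map fun i => D.t i ^ a i.castSucc).prod := by
      intro l
      have hpow : ∀ i k, WreathRep.ActsAs (D.phi lam hlam) (D.ind.t (Fin.castSucc i) ^ k)
          (D.t i ^ k) := by
        intro i k
        induction k with
        | zero => simpa using WreathRep.ActsAs.scalar (φ := D.phi lam hlam) (1 : R)
        | succ k ih => rw [pow_succ, pow_succ]; exact ih.mul (D.actsAs_t lam hlam i)
      induction l with
      | nil => simpa using WreathRep.ActsAs.scalar (φ := D.phi lam hlam) (1 : R)
      | cons i l ih => simpa using (hpow _ _).mul ih
    have key : D.coeff lam hlam ((List.ofFn fun i => D.ind.t i ^ a i).prod * D.ind.σ w) =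
        (List.ofFn fun i => D.t i ^ a i.castSucc).prod *
          D.phi lam hlam (D.e (a (Fin.last n)) w) := by
      have := hacts (List.finRange n)
      rw [← List.ofFn_eq_map, ← List.ofFn_eq_map] at this
      rw [List.ofFn_succ', List.prod_concat, mul_assoc, D.coeff_mul_left lam hlam this,
        D.coeff_t_last_pow_mul_σ]
    change (model p lam hlam n).tr (D.coeff lam hlam _) = _
    refine (congrArg _ key).trans ?_
    by_cases h : w ∈ (extendPerm n).range
    · obtain ⟨g, rfl⟩ := h
      rw [D.phi_e_extendPerm, mul_smul_comm, map_smul, ih _ fun i => ha _]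
      by_cases hl : a (Fin.last n) = 0
      · rw [hl, h0, one_smul]
        refine if_congr ?_ rfl rfl
        rw [Fin.forall_fin_succ', map_eq_one_iff _ (extendPerm_injective n)]
        simp [hl]
      · rw [hm _ (Nat.one_le_iff_ne_zero.2 hl) (ha _), zero_smul, if_neg fun h => hl (h.1 _)]
    · rw [D.phi_e_of_not lam hlam h, mul_zero, map_zero, if_neg]
      rintro ⟨_, rfl⟩
      exact h (one_mem _)

end DegHecke

/-! ### The direct limit and the canonical trace -/

namespace DegHecke

open Polynomial Equiv

variable {R : Type} [CommRing R] {m : ℕ} (u : Fin m → R)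

/-- The canonical map `H_n(u) → H_∞(u)` as a homomorphism of algebras. -/
def toInfAlg (n : ℕ) (hn : 0 < n) : Hecke u n →ₐ[R] HeckeInf u :=
  DirectLimit.Algebra.of (R := R) (fun n : ℕ+ => Hecke u n)
    (fun (n k : ℕ+) (h : n ≤ k) => incl u (PNat.coe_le_coe n k |>.mpr h)) ⟨n, hn⟩

theorem toInf_eq (n : ℕ+) (x : Hecke u n) : toInf u n x = toInfAlg u n n.pos x := rfl

theorem toInfAlg_incl {n k : ℕ} (hn : 0 < n) (h : n ≤ k) (x : Hecke u n) :
    toInfAlg u k (hn.trans_le h) (incl u h x) = toInfAlg u n hn x :=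
  DirectLimit.Algebra.of_f (ι := ℕ+) (G := fun n : ℕ+ => Hecke u n)
    (f := fun (n k : ℕ+) (h : n ≤ k) => incl u (PNat.coe_le_coe n k |>.mpr h))
    (i := ⟨n, hn⟩) (j := ⟨k, hn.trans_le h⟩) h x

theorem incl_S {n k : ℕ} (h : n ≤ k) (i : SimpleIdx n) :
    incl u h (S u i) = S u ⟨i.1, i.2.1, i.2.2.trans_le h⟩ := incl_quot_ι u h (Gen.s i)

theorem incl_T {n k : ℕ} (h : n ≤ k) : incl u h (T u n) = T u k := incl_quot_ι u h Gen.t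

/-- `s_{i+1}` in `H_∞(u)`. -/
def sInf (i : ℕ) : HeckeInf u :=
  toInfAlg u (i + 2) (Nat.succ_pos _) (S u ⟨i + 1, Nat.succ_pos i, Nat.lt_succ_self _⟩)

/-- `t` in `H_∞(u)`. -/
def tInf : HeckeInf u := toInfAlg u 1 one_pos (T u 1)

theorem toInfAlg_S {n : ℕ} (hn : 0 < n) {i : ℕ} (hi : 1 ≤ i + 1 ∧ i + 1 < n) :
    toInfAlg u n hn (S u ⟨i + 1, hi⟩) = sInf u i := by
  rw [sInf, ← toInfAlg_incl u _ (show i + 2 ≤ n from hi.2), incl_S]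

theorem toInfAlg_T {n : ℕ} (hn : 0 < n) : toInfAlg u n hn (T u n) = tInf u := by
  rw [tInf, ← toInfAlg_incl u _ (show 1 ≤ n from hn), incl_T]

theorem quot_S {n : ℕ} (i : SimpleIdx n) : quot u n (freeS R i) = S u i := rfl

theorem quot_T (n : ℕ) : quot u n (freeT R n) = T u n := rfl

/-- The generators of `H_∞(u)`. -/
def gensInf : AffineGens (HeckeInf u) where
  t := tInf u
  s := sInf u
  s_sq i := by
    have := congrArg (toInfAlg u (i + 2) (Nat.succ_pos _))
      (quot_rel u (Rel.s_sq (u := u) ⟨i + 1, Nat.succ_pos i, Nat.lt_succ_self _⟩))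
    simpa only [map_mul, map_one, quot_S, toInfAlg_S] using this
  braid i := by
    have := congrArg (toInfAlg u (i + 3) (Nat.succ_pos _))
      (quot_rel u (Rel.braid (u := u) ⟨i + 1, by omega⟩ ⟨i + 2, by omega⟩ rfl))
    simpa only [map_mul, quot_S, toInfAlg_S] using this
  s_comm i j hij := by
    have := congrArg (toInfAlg u (j + 2) (Nat.succ_pos _))
      (quot_rel u (Rel.s_comm (u := u) ⟨i + 1, by omega⟩ ⟨j + 1, by omega⟩
        (Or.inl (by simpa using hij))))
    rw [commute_iff_eq]
    simpa only [map_mul, quot_S, toInfAlg_S] using this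
  t_s i := by
    have := congrArg (toInfAlg u (i + 3) (Nat.succ_pos _))
      (quot_rel u (Rel.t_s (u := u) ⟨i + 2, by omega⟩ (by simp)))
    rw [commute_iff_eq]
    simpa only [map_mul, quot_S, quot_T, toInfAlg_S, toInfAlg_T] using this
  t_s_zero := by
    have := congrArg (toInfAlg u 2 (Nat.succ_pos _))
      (quot_rel u (Rel.t_s_one (u := u) ⟨0 + 1, by omega⟩ rfl))
    rw [commute_iff_eq]
    simpa only [map_mul, map_add, quot_S, quot_T, toInfAlg_S, toInfAlg_T] using this

theorem toInfAlg_tElt {n : ℕ} (hn : 0 < n) {k : ℕ} (hk : k < n) :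
    toInfAlg u n hn (tElt u n k hk) = (gensInf u).te k := by
  induction k with
  | zero => exact toInfAlg_T u hn
  | succ k ih => rw [tElt, map_mul, map_mul, toInfAlg_S, ih]; rfl

theorem tSuccElemInf_eq (i : ℕ+) : tSuccElemInf u i = (gensInf u).te i :=
  toInfAlg_tElt u (i + 1 : ℕ+).2 (Nat.lt_succ_self _)

theorem toInfAlg_mem_level {n : ℕ} (hn : 0 < n) (x : Hecke u n) :
    toInfAlg u n hn x ∈ (gensInf u).level R n := by
  obtain ⟨n, rfl⟩ : ∃ k, n = k + 1 := ⟨n - 1, by omega⟩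
  refine hecke_induction u (P := fun x => toInfAlg u (n + 1) hn x ∈ (gensInf u).level R (n + 1))
    (fun r => ?_) (fun g => ?_) (fun x y hx hy => ?_) (fun x y hx hy => ?_) x
  · rw [AlgHom.commutes]; exact Subalgebra.algebraMap_mem _ r
  · cases g with
    | t => exact (toInfAlg_T u hn).symm ▸ (gensInf u).t_mem_level n
    | s i =>
      obtain ⟨i, hi⟩ := i
      obtain ⟨i, rfl⟩ : ∃ k, i = k + 1 := ⟨i - 1, by omega⟩
      exact (toInfAlg_S u hn hi).symm ▸ (gensInf u).s_mem_level (by omega)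
  · rw [map_add]; exact add_mem hx hy
  · rw [map_mul]; exact mul_mem hx hy

theorem exists_of_mem_level {n : ℕ} {x : HeckeInf u} (hx : x ∈ (gensInf u).level R (n + 1)) :
    ∃ y : Hecke u (n + 1), toInfAlg u (n + 1) (Nat.succ_pos n) y = x := by
  refine ((gensInf u).level_le (A := (toInfAlg u (n + 1) (Nat.succ_pos n)).range) ?_ ?_) hx
  · exact ⟨_, toInfAlg_T u _⟩
  · exact fun i hi => ⟨_, toInfAlg_S u _ ⟨Nat.succ_pos i, Nat.succ_lt_succ hi⟩⟩

theorem exists_mem_level (x : HeckeInf u) : ∃ n, x ∈ (gensInf u).level R n := by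
  induction x using DirectLimit.induction with
  | _ n x => exact ⟨n, toInfAlg_mem_level u n.pos x⟩

theorem exists_mem_level₂ (x y : HeckeInf u) :
    ∃ n, x ∈ (gensInf u).level R n ∧ y ∈ (gensInf u).level R n := by
  obtain ⟨a, ha⟩ := exists_mem_level u x
  obtain ⟨b, hb⟩ := exists_mem_level u y
  exact ⟨max a b, (gensInf u).level_mono (le_max_left a b) ha,
    (gensInf u).level_mono (le_max_right a b) hb⟩

/-- The cyclotomic polynomial `(X - u_1) ⋯ (X - u_m)`. -/
abbrev cycPoly : R[X] := ∏ j, (X - C (u j))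

/-- Conjugation by the involution `s n` commutes with evaluating polynomials. -/
theorem aeval_te_gensInf (n : ℕ) : aeval ((gensInf u).te n) (cycPoly u) = 0 := by
  induction n with
  | zero =>
    have := congrArg (toInfAlg u 1 one_pos) (quot_rel u (Rel.cyclotomic (u := u) (n := 1)))
    change aeval (tInf u) _ = 0
    rw [cycPoly, ← List.prod_ofFn]
    simpa only [map_list_prod, List.map_ofFn, Function.comp_def, map_sub, map_zero,
      AlgHom.commutes, aeval_X, aeval_C, quot_T, toInfAlg_T] using this
  | succ n ih =>
    have : ∀ q : R[X], aeval ((gensInf u).te (n + 1)) q =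
        (gensInf u).s n * aeval ((gensInf u).te n) q * (gensInf u).s n := by
      intro q
      induction q using Polynomial.induction_on' with
      | add q r hq hr => rw [map_add, map_add, hq, hr, mul_add, add_mul]
      | monomial k a =>
        rw [aeval_monomial, aeval_monomial, AffineGens.te, ← AffineGens.conj_pow,
          ← Algebra.smul_def, ← Algebra.smul_def, mul_smul_comm, smul_mul_assoc]
    rw [this, ih, mul_zero, zero_mul]

/-- The linear form on polynomials taking the constant coefficient of the remainder modulo the
cyclotomic polynomial. -/
def remCoeff : R[X] →ₗ[R] R := lcoeff R 0 ∘ₗ modByMonicHom (cycPoly u)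

/-- The value of the canonical trace at `t^k`. -/
def lam (k : ℕ) : R := remCoeff u (X ^ k)

theorem cycPoly_monic : (cycPoly u).Monic := monic_prod_of_monic _ _ fun j _ => monic_X_sub_C (u j)

theorem natDegree_cycPoly [Nontrivial R] : (cycPoly u).natDegree = m := by
  rw [cycPoly, natDegree_prod_of_monic _ _ fun j _ => monic_X_sub_C (u j)]
  simp

/-- The sum is `remCoeff` of `X^k` times the cyclotomic polynomial, whose remainder is zero. This
recurrence is what makes `phi` well defined. -/
theorem sum_lam (k : ℕ) : ((cycPoly u).sum fun l a => a * lam u (k + l)) = 0 := by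
  have h : remCoeff u (X ^ k * cycPoly u) = 0 := by
    have : modByMonicHom (cycPoly u) (X ^ k * cycPoly u) = 0 :=
      (mem_ker_modByMonic (cycPoly_monic u)).2 (dvd_mul_left _ _)
    rw [remCoeff, LinearMap.comp_apply, this, map_zero]
  rw [← h]
  conv_rhs => rw [(cycPoly u).as_sum_support_C_mul_X_pow]
  simp only [Polynomial.sum, Finset.mul_sum, map_sum, lam]
  refine Finset.sum_congr rfl fun l _ => ?_
  rw [← mul_assoc, mul_comm (X ^ k), mul_assoc, ← pow_add, ← smul_eq_C_mul, map_smul, smul_eq_mul]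

theorem lam_of_lt [Nontrivial R] {k : ℕ} (hk : k < m) : lam u k = if k = 0 then 1 else 0 := by
  have : X ^ k %ₘ cycPoly u = X ^ k := by
    rw [modByMonic_eq_self_iff (cycPoly_monic u), degree_X_pow,
      degree_eq_natDegree (cycPoly_monic u).ne_zero, natDegree_cycPoly]
    exact_mod_cast hk
  change (X ^ k %ₘ cycPoly u).coeff 0 = _
  rw [this, coeff_X_pow]
  simp only [eq_comm]

/-- The model of `H_n(u)`. -/
abbrev heckeModel (n : ℕ) : Model (cycPoly u) n := model (cycPoly u) (lam u) (sum_lam u) n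

/-- The canonical trace on `H_n(u)`. -/
def trLevel (n : ℕ) (hn : 0 < n) : Hecke u n →ₗ[R] R :=
  (heckeModel u n).tr ∘ₗ ((heckeModel u n).rep.toAlg hn).toLinearMap

theorem trLevel_succ (n : ℕ) (x : Hecke u (n + 1)) :
    trLevel u (n + 1) (Nat.succ_pos n) x = (heckeModel u n).tr ((heckeModel u n).rep.coeff (lam u)
      (sum_lam u) ((heckeModel u n).rep.ind.toAlg (Nat.succ_pos n) x)) := rfl

theorem incl_incl {n k l : ℕ} (h : n ≤ k) (h' : k ≤ l) (x : Hecke u n) :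
    incl u h' (incl u h x) = incl u (h.trans h') x := by
  have : (incl u h').comp (incl u h) = incl u (h.trans h') := by
    apply algHom_ext
    intro g
    rw [AlgHom.comp_apply, incl_quot_ι, incl_quot_ι, incl_quot_ι]
    cases g <;> rfl
  exact congrArg (fun f => f x) this

theorem incl_self {n : ℕ} (x : Hecke u n) : incl u le_rfl x = x := by
  have : incl u (le_refl n) = AlgHom.id R _ := by
    apply algHom_ext
    intro g
    rw [incl_quot_ι]
    cases g <;> rfl
  exact congrArg (fun f => f x) this

theorem lam_zero [Nontrivial R] (hm : 1 ≤ m) : lam u 0 = 1 := by rw [lam_of_lt u hm, if_pos rfl]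

theorem trLevel_incl_mul {n : ℕ} (hn : 0 < n) (x : Hecke u n) (k : ℕ) :
    trLevel u (n + 1) (Nat.succ_pos n) (incl u (Nat.le_succ n) x *
      tElt u (n + 1) n (Nat.lt_succ_self n) ^ k) = lam u k * trLevel u n hn x := by
  rw [trLevel_succ, map_mul, map_pow, WreathRep.toAlg_tElt,
    WreathRep.coeff_mul_left _ _ _ (WreathRep.actsAs_incl _ _ _ hn x)]
  change (heckeModel u n).tr (_ * WreathRep.coeff _ _ _
    ((heckeModel u n).rep.ind.t (Fin.last n) ^ k)) = _
  rw [WreathRep.coeff_t_last_pow, mul_smul_comm, mul_one, map_smul, smul_eq_mul]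
  rfl

theorem trLevel_one_T_pow (k : ℕ) : trLevel u 1 one_pos (T u 1 ^ k) = lam u k := by
  rw [trLevel_succ, map_pow]
  have h : (heckeModel u 0).rep.ind.toAlg (Nat.succ_pos 0) (T u 1) =
      (heckeModel u 0).rep.ind.t (Fin.last 0) := (heckeModel u 0).rep.ind.toAlg_tElt _ 0 one_pos
  rw [h, WreathRep.coeff_t_last_pow]
  exact mul_one (lam u k)

theorem trLevel_mid {n : ℕ} (hn : 0 < n) (x y : Hecke u n) :
    trLevel u (n + 1) (Nat.succ_pos n) (incl u (Nat.le_succ n) x *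
      S u ⟨n, hn, Nat.lt_succ_self n⟩ * incl u (Nat.le_succ n) y) = 0 := by
  rw [trLevel_succ, map_mul (WreathRep.toAlg _ _), map_mul (WreathRep.toAlg _ _),
    WreathRep.toAlg_S,
    WreathRep.coeff_mul_right _ _ _ (WreathRep.actsAs_incl _ _ _ hn y),
    WreathRep.coeff_mul_left _ _ _ (WreathRep.actsAs_incl _ _ _ hn x),
    WreathRep.coeff_σ_of_not _ _ _ (WreathRep.adjSwap_notMem_range hn), mul_zero, zero_mul,
    map_zero]

section Nontrivial

variable [Nontrivial R]

theorem trLevel_incl_succ {n : ℕ} (hm : 1 ≤ m) (hn : 0 < n) (x : Hecke u n) :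
    trLevel u (n + 1) (Nat.succ_pos n) (incl u (Nat.le_succ n) x) = trLevel u n hn x := by
  have := trLevel_incl_mul u hn x 0
  rwa [pow_zero, mul_one, lam_zero u hm, one_mul] at this

/-- Compatibility of the levels rests on `lam 0 = 1`, which needs `m ≥ 1`: for `m = 0` every
remainder is zero. -/
theorem trLevel_incl (hm : 1 ≤ m) {n k : ℕ} (hn : 0 < n) (h : n ≤ k) (x : Hecke u n) :
    trLevel u k (hn.trans_le h) (incl u h x) = trLevel u n hn x := by
  induction k, h using Nat.le_induction with
  | base => rw [incl_self]
  | succ k h ih =>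
    rw [← incl_incl u h (Nat.le_succ k), trLevel_incl_succ u hm (hn.trans_le h), ih]

theorem trLevel_one_one (hm : 1 ≤ m) : trLevel u 1 one_pos 1 = 1 := by
  rw [← pow_zero (T u 1), trLevel_one_T_pow, lam_zero u hm]

/-- The canonical trace on `H_∞(u)`. -/
def trInf (hm : 1 ≤ m) : HeckeInf u →ₗ[R] R :=
  DirectLimit.Module.lift R ℕ+ (fun n : ℕ+ => Hecke u n)
    (fun (n k : ℕ+) (h : n ≤ k) => incl u (PNat.coe_le_coe n k |>.mpr h))
    (fun n => trLevel u n n.pos) fun n _ h x => trLevel_incl u hm n.pos h x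

theorem trInf_toInfAlg (hm : 1 ≤ m) {n : ℕ} (hn : 0 < n) (x : Hecke u n) :
    trInf u hm (toInfAlg u n hn x) = trLevel u n hn x := rfl

theorem trInf_one (hm : 1 ≤ m) : trInf u hm 1 = 1 := by
  rw [← map_one (toInfAlg u 1 one_pos), trInf_toInfAlg, trLevel_one_one u hm]

theorem isReducing_trInf (hm : 1 ≤ m) : (gensInf u).IsReducing (lam u) (trInf u hm) where
  te_pow n h hh k := by
    cases n with
    | zero =>
      obtain ⟨r, rfl⟩ := Algebra.mem_bot.1 hh
      have : (gensInf u).te 0 ^ k = toInfAlg u 1 one_pos (T u 1 ^ k) := by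
        rw [map_pow]; rfl
      rw [this, ← Algebra.smul_def, map_smul, trInf_toInfAlg, trLevel_one_T_pow,
        Algebra.algebraMap_eq_smul_one, map_smul, trInf_one, smul_eq_mul, smul_eq_mul, mul_one,
        mul_comm]
    | succ n =>
      obtain ⟨x, rfl⟩ := exists_of_mem_level u hh
      rw [trInf_toInfAlg, ← trLevel_incl_mul, ← trInf_toInfAlg u hm, map_mul (toInfAlg _ _ _),
        map_pow (toInfAlg _ _ _), toInfAlg_tElt, toInfAlg_incl u (Nat.succ_pos n)]
  mid n x hx := by
    refine (AffineGens.mid_le fun h hh h' hh' => ?_ :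
      (gensInf u).mid R n ≤ LinearMap.ker (trInf u hm)) hx
    obtain ⟨x, rfl⟩ := exists_of_mem_level u hh
    obtain ⟨y, rfl⟩ := exists_of_mem_level u hh'
    rw [LinearMap.mem_ker, ← trLevel_mid u (Nat.succ_pos n) x y, ← trInf_toInfAlg u hm,
      map_mul (toInfAlg _ _ _), map_mul (toInfAlg _ _ _), toInfAlg_incl u (Nat.succ_pos n), toInfAlg_incl u (Nat.succ_pos n), toInfAlg_S]
    rfl

theorem isMarkov_of_isReducing {tr : HeckeInf u →ₗ[R] R} (h1 : tr 1 = 1)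
    (H : (gensInf u).IsReducing (lam u) tr) : IsNormalizedMarkovTrace u 0 0 tr where
  map_one := h1
  map_mul_comm a b := by
    obtain ⟨n, ha, hb⟩ := exists_mem_level₂ u a b
    exact H.mul_comm ha hb
  map_mul_s i a := by
    obtain ⟨i, hi⟩ := i
    obtain ⟨i, rfl⟩ : ∃ k, i = k + 1 := ⟨i - 1, by omega⟩
    have := H.mid i _ (AffineGens.mem_mid (toInfAlg_mem_level u hi a) (one_mem _))
    rw [mul_one] at this
    rw [zero_mul]
    exact this
  map_mul_t_pow i a k hk hkm := by
    rw [tSuccElemInf_eq, toInf_eq, H.te_pow i _ (toInfAlg_mem_level u i.pos a), lam_of_lt u hkm,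
      if_neg (by omega)]
    rfl

/-- The Markov conditions give the exponents below `m`; reduction modulo the cyclotomic polynomial
gives the others. Vanishing on `h s h'` follows by moving `h'` cyclically to the front. -/
theorem isReducing_of_isMarkov (hm : 1 ≤ m) {tr : HeckeInf u →ₗ[R] R}
    (H : IsNormalizedMarkovTrace u 0 0 tr) : (gensInf u).IsReducing (lam u) tr where
  te_pow n h hh k := by
    have key : ∀ j < m, tr (h * (gensInf u).te n ^ j) = (if j = 0 then 1 else 0) * tr h := by
      intro j hj
      split_ifs with h0
      · rw [h0, pow_zero, mul_one, one_mul]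
      · rw [zero_mul]
        have hsucc : ∀ i : ℕ+, ∀ a : Hecke u i,
            tr (toInfAlg u i i.pos a * (gensInf u).te i ^ j) = 0 := by
          intro i a
          have := H.map_mul_t_pow i a j (Nat.one_le_iff_ne_zero.2 h0) hj
          rwa [tSuccElemInf_eq, toInf_eq, Pi.zero_apply, zero_mul] at this
        cases n with
        | zero =>
          obtain ⟨r, rfl⟩ := Algebra.mem_bot.1 hh
          -- The Markov condition says nothing directly about `t_1`; its powers are handled as
          -- conjugates of the powers of `t_2`.
          have := hsucc 1 1
          rw [map_one, one_mul, PNat.one_coe, AffineGens.te, ← AffineGens.conj_pow,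
            H.map_mul_comm, ← mul_assoc, (gensInf u).s_sq, one_mul] at this
          rw [← Algebra.smul_def, map_smul, this, smul_zero]
        | succ n =>
          obtain ⟨x, rfl⟩ := exists_of_mem_level u hh
          exact hsucc ⟨n + 1, Nat.succ_pos n⟩ x
    have hmod : (gensInf u).te n ^ k =
        aeval ((gensInf u).te n) (X ^ k %ₘ cycPoly u) := by
      have := congrArg (aeval ((gensInf u).te n)) (modByMonic_add_div (X ^ k) (cycPoly u))
      rw [map_add, map_mul, aeval_te_gensInf, zero_mul, add_zero, map_pow, aeval_X] at this
      exact this.symm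
    have hdeg : (X ^ k %ₘ cycPoly u).natDegree < m := by
      have := natDegree_modByMonic_lt (X ^ k) (cycPoly_monic u) fun h => by
        have := natDegree_cycPoly u
        rw [h, natDegree_one] at this
        omega
      rwa [natDegree_cycPoly] at this
    rw [hmod, aeval_eq_sum_range' hdeg, Finset.mul_sum, map_sum]
    simp only [mul_smul_comm, map_smul]
    rw [Finset.sum_congr rfl fun j hj => by rw [key j (Finset.mem_range.1 hj)]]
    simp only [ite_mul, one_mul, zero_mul, smul_eq_mul, mul_ite, mul_zero, Finset.sum_ite_eq',
      Finset.mem_range]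
    -- Only the constant coefficient of the remainder survives, and it is `lam u k` by definition;
    -- the condition is `0 < m`.
    rw [if_pos (by omega)]
    rfl
  mid n x hx := by
    refine (AffineGens.mid_le fun h hh h' hh' => ?_ :
      (gensInf u).mid R n ≤ LinearMap.ker tr) hx
    obtain ⟨y, hy⟩ := exists_of_mem_level u (mul_mem hh' hh)
    have := H.map_mul_s ⟨n + 1, Nat.succ_pos n⟩ y
    rw [zero_mul] at this
    rw [LinearMap.mem_ker, H.map_mul_comm, ← mul_assoc, ← hy]
    exact this

theorem eq_trInf (hm : 1 ≤ m) {tr : HeckeInf u →ₗ[R] R} (H : IsNormalizedMarkovTrace u 0 0 tr) :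
    tr = trInf u hm := by
  refine LinearMap.ext fun x => ?_
  obtain ⟨n, hx⟩ := exists_mem_level u x
  exact (isReducing_of_isMarkov u hm H).eq_of_map_one (isReducing_trInf u hm)
    (H.map_one.trans (trInf_one u hm).symm) hx

theorem isMarkov_trInf (hm : 1 ≤ m) : IsNormalizedMarkovTrace u 0 0 (trInf u hm) :=
  isMarkov_of_isReducing u (trInf_one u hm) (isReducing_trInf u hm)

theorem isCanonicalTrace_trInf (hm : 1 ≤ m) (n : ℕ+) :
    IsCanonicalTrace u n (trInf u hm ∘ₗ toInf u n) where
  map_mul_comm a b := by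
    simp only [LinearMap.comp_apply, toInf_eq, map_mul]
    exact (isMarkov_trInf u hm).map_mul_comm _ _
  map_word a ha w l hl := by
    rw [← model_tr_word (sum_lam u) (lam_zero u hm)
      (fun k hk hkm => by rw [lam_of_lt u hkm, if_neg (by omega)]) n a ha w, LinearMap.comp_apply,
      toInf_eq, trInf_toInfAlg]
    change (heckeModel u n).tr ((heckeModel u n).rep.toAlg n.pos _) = _
    rw [map_mul, WreathRep.toAlg_word, hl, map_list_prod, List.map_ofFn]
    simp only [Function.comp_def, map_pow, WreathRep.toAlg_tElt]

end Nontrivial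

end DegHecke
end

theorem mainTheorem4 (m : ℕ) (hm : 1 ≤ m) :
    (∃! tr : DegHecke.HeckeInf (DegHecke.indet m) →ₗ[DegHecke.RatField m] DegHecke.RatField m,
      DegHecke.IsNormalizedMarkovTrace (DegHecke.indet m) 0 0 tr) ∧
    ∀ tr : DegHecke.HeckeInf (DegHecke.indet m) →ₗ[DegHecke.RatField m] DegHecke.RatField m,
      DegHecke.IsNormalizedMarkovTrace (DegHecke.indet m) 0 0 tr →
        ∀ n : ℕ+, DegHecke.IsCanonicalTrace (DegHecke.indet m) n
          (tr ∘ₗ DegHecke.toInf (DegHecke.indet m) n) := by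
  refine ⟨⟨DegHecke.trInf _ hm, DegHecke.isMarkov_trInf _ hm,
    fun tr H => DegHecke.eq_trInf _ hm H⟩, fun tr H n => ?_⟩
  rw [DegHecke.eq_trInf _ hm H]
  exact DegHecke.isCanonicalTrace_trInf _ hm n
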